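/- **Model.** A team $R$ of $n$ anonymous, identical, silent and oblivious point robots ($\mathcal{OBLOT}$) moves in the Euclidean plane in synchronous rounds. In each round every activated robot takes a snapshot (the set of positions of the robots it observes, itself included, in its own local coordinate system centred at itself), computes a destination by a deterministic algorithm that is common to all robots, and moves straight towards it. Local coordinate systems may differ by rotation, reflection and unit of length. A team has a visibility radius $V_r>0$, which the robots know (in their own unit of length) in both visibility models; a guaranteed minimal movement $\delta\in(0,\infty]$ (a robot reaches its destination unless the adversary stops it after it has covered at least $\delta$; $\delta=\infty$ means rigid movements); and a nonempty set of admissible choices of the local coordinate systems of all robots in all rounds (which expresses their agreement), from which the adversary chooses. Under full visibility ($F.V.$) a robot observes all robots; under limited visibility ($L.V.$) it observes exactly the robots at distance at most $V_r$. Under $\mathrm{FSYNCH}$ all robots are activated in every round; under $\mathrm{SSYNCH}$ the adversary activates an arbitrary set of robots in every round, such that every robot is activated infinitely often. A problem for $n$ robots is given by a set of initial configurations and a set of correct evolutions of the positions. The set $\mathcal{OBLOT}^S_V(R)$ consists of the problems all of whose initial configurations have a connected visibility graph (under $F.V.$ that graph is complete) and for which some algorithm has only correct executions by $R$ under scheduler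 $S$ with visibility $V$. Write $\mathcal{OBLOT}^{S_1}_{V_1}>\mathcal{OBLOT}^{S_2}_{V_2}$ if $\mathcal{OBLOT}^{S_1}_{V_1}(R)\supseteq \mathcal{OBLOT}^{S_2}_{V_2}(R)$ for every team $R$, and the inclusion is strict for some team $R$. **Angle Equalization (AE).** Robots $r_1,r_2,r_3,r_4$ are at points $A,B,C,D$ such that the ray $BA$ makes an acute angle $\theta_1>0$ with the extension of $CB$ beyond $B$, the ray $CD$ makes an acute angle $\theta_2$ with the extension of $BC$ beyond $C$, $\theta_1<\theta_2<90^\circ$, and $|AB|\le|BC|$, $|CD|\le|BC|$. Without any collision (neither at the beginning of a round nor while the robots move) and without any movement of $r_2$ and $r_3$, the robots must reach in finite time, and then keep, a configuration in which both angles equal the initial $\theta_2$. **Theorem.** 1. $\mathcal{OBLOT}^F_{F.V.}>\mathcal{OBLOT}^F_{L.V.}$ and $\mathcal{OBLOT}^S_{F.V.}>\mathcal{OBLOT}^S_{L.V.}$, where $F$, $S$ stand for $\mathrm{FSYNCH}$, $\mathrm{SSYNCH}$. 2. There is one algorithm, not using $V_r$, that solves AE under full visibility for every team of four robots, under $\mathrm{FSYNCH}$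 and under $\mathrm{SSYNCH}$, in such a way that no robot other than $r_1$ ever moves. 3. For every $V_r>0$, let $R$ be the team of four robots with visibility radius $V_r$ and rigid movements whose local coordinate systems are chosen by the adversary arbitrarily and afresh in every round. Then AE, restricted to the initial configurations whose visibility graph for the radius $V_r$ is connected, is solvable by $R$ under full visibility, but not under limited visibility, both under $\mathrm{FSYNCH}$ and under $\mathrm{SSYNCH}$. -/

import Mathlib

open scoped ENNReal

noncomputable section

namespace MobileRobots

/-- The Euclidean plane in which the robots move. -/
abbrev Plane : Type := EuclideanSpace ℝ (Fin 2)

/-- The positions of `n` robots; the indices serve the observer only, robots do not see them. -/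
abbrev Config (n : ℕ) : Type := Fin n → Plane

/-- The orientation of the axes (a rotation, possibly followed by a reflection) and the unit of
length of a local coordinate system; its origin is always the robot that uses it. -/
structure Frame where
  axes : Plane ≃ₗᵢ[ℝ] Plane
  scale : ℝ
  scale_pos : 0 < scale

/-- Local coordinates of the point `q` for a robot located at `p`. -/
def Frame.toLocal (F : Frame) (p q : Plane) : Plane := F.scale • F.axes (q - p)

/-- The point with local coordinates `x` for a robot located at `p`. -/
def Frame.toGlobal (F : Frame) (p x : Plane) : Plane := p + F.axes.symm (F.scale⁻¹ • x)

theorem Frame.toGlobal_toLocal (F : Frame) (p q : Plane) :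
    F.toGlobal p (F.toLocal p q) = q := by
  simp [Frame.toGlobal, Frame.toLocal, smul_smul, inv_mul_cancel₀ F.scale_pos.ne']

/-- A team of `n` robots with identical capabilities.
* `radius` is the constant `V_r`, used by the sensors in the limited visibility model.
* `minMove` describes the movements: a robot that is stopped by the adversary before its
  destination has covered at least this distance. The value `⊤` means rigid movements.
* `frames` is the set of all ways in which the adversary may choose the local coordinate system
  of every robot in every round. It expresses the agreement of the robots: it may force common
  coordinate systems, or a common chirality, or coordinate systems that never change, or
  nothing at all. -/
structure Team (n : ℕ) where
  radius : ℝ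
  radius_pos : 0 < radius
  minMove : ℝ≥0∞
  minMove_pos : 0 < minMove
  frames : Set (ℕ → Fin n → Frame)
  frames_nonempty : frames.Nonempty

inductive Visibility where
  | full
  | limited

inductive Scheduler where
  | fsynch
  | ssynch

/-- A robot of the team located at `p` observes a robot located at `q`. -/
def Sees {n : ℕ} (R : Team n) : Visibility → Plane → Plane → Prop
  | .full, _, _ => True
  | .limited, p, q => dist p q ≤ R.radius

/-- The visibility graph of a configuration. -/
def visibilityGraph {n : ℕ} (R : Team n) (V : Visibility) (p : Config n) : SimpleGraph (Fin n) :=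
  SimpleGraph.fromRel fun i j => Sees R V (p i) (p j)

/-- The snapshot taken by robot `i`: the set of positions of the robots that it observes (itself
included), in local coordinates. -/
def snapshot {n : ℕ} (R : Team n) (V : Visibility) (F : Frame) (p : Config n) (i : Fin n) :
    Set Plane :=
  {x | ∃ j, Sees R V (p i) (p j) ∧ x = F.toLocal (p i) (p j)}

/-- A deterministic algorithm for oblivious silent anonymous robots: from the constant `V_r`,
expressed in the robot's own unit of length, and the current snapshot, it computes a destination
in local coordinates. -/
abbrev Algorithm : Type := ℝ → Set Plane → Plane

/-- The destination computed by robot `i` in configuration `p`. -/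
def destination {n : ℕ} (R : Team n) (V : Visibility) (f : Algorithm) (F : Frame)
    (p : Config n) (i : Fin n) : Plane :=
  F.toGlobal (p i) (f (F.scale * R.radius) (snapshot R V F p i))

/-- A straight move from `p` towards `q` that ends in `p'`: the destination is reached, or the
adversary stops the robot after it has covered at least the distance `δ`. -/
def Moves (δ : ℝ≥0∞) (p q p' : Plane) : Prop :=
  p' ∈ segment ℝ p q ∧ (p' = q ∨ δ ≤ edist p p')

/-- The activation sequences that a scheduler may produce: all robots in every round, or any
sequence of sets in which every robot appears infinitely often. -/
def Scheduler.Allows {n : ℕ} : Scheduler → (ℕ → Set (Fin n)) → Prop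
  | .fsynch, act => ∀ t, act t = Set.univ
  | .ssynch, act => ∀ i t, ∃ t', t ≤ t' ∧ i ∈ act t'

/-- `pos t i` is the position of robot `i` at the beginning of round `t`, in some execution of the
algorithm `f`. During round `t` robot `i` moves along the segment from `pos t i` to
`pos (t + 1) i`. -/
def IsExecution {n : ℕ} (f : Algorithm) (S : Scheduler) (V : Visibility) (R : Team n)
    (pos : ℕ → Config n) : Prop :=
  ∃ act : ℕ → Set (Fin n), S.Allows act ∧ ∃ F ∈ R.frames, ∀ t i,
    (i ∈ act t →
      Moves R.minMove (pos t i) (destination R V f (F t i) (pos t) i) (pos (t + 1) i)) ∧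
    (i ∉ act t → pos (t + 1) i = pos t i)

/-- A problem for `n` robots: the possible initial configurations, and the set of evolutions that
are regarded as correct. -/
structure Problem (n : ℕ) where
  init : Set (Config n)
  correct : Set (ℕ → Config n)

/-- Every execution of `f` that starts in an initial configuration of `P` is correct. -/
def Solves {n : ℕ} (f : Algorithm) (S : Scheduler) (V : Visibility) (R : Team n)
    (P : Problem n) : Prop :=
  ∀ pos : ℕ → Config n, pos 0 ∈ P.init → IsExecution f S V R pos → pos ∈ P.correct

/-- `Task(OBLOT, S, V; R)`: the problems, with initial configurations whose visibility graph is
connected, that are solvable by the team `R` of oblivious robots. -/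
def Task {n : ℕ} (S : Scheduler) (V : Visibility) (R : Team n) : Set (Problem n) :=
  {P | (∀ p ∈ P.init, (visibilityGraph R V p).Connected) ∧ ∃ f, Solves f S V R P}

/-- `OBLOT` with `S₁`, `V₁` is computationally not less powerful than with `S₂`, `V₂`. -/
def NotLessPowerful (S₁ : Scheduler) (V₁ : Visibility) (S₂ : Scheduler) (V₂ : Visibility) : Prop :=
  ∀ (n : ℕ) (R : Team n), Task S₂ V₂ R ⊆ Task S₁ V₁ R

/-- `OBLOT` with `S₁`, `V₁` is computationally more powerful than with `S₂`, `V₂`. -/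
def MorePowerful (S₁ : Scheduler) (V₁ : Visibility) (S₂ : Scheduler) (V₂ : Visibility) : Prop :=
  NotLessPowerful S₁ V₁ S₂ V₂ ∧ ∃ (n : ℕ) (R : Team n), (Task S₁ V₁ R \ Task S₂ V₂ R).Nonempty

/-- No two robots are ever at the same point at the same time, also while they are moving. -/
def CollisionFree {n : ℕ} (pos : ℕ → Config n) : Prop :=
  ∀ t i j, i ≠ j → ∀ s ∈ Set.Icc (0 : ℝ) 1,
    AffineMap.lineMap (pos t i) (pos (t + 1) i) s ≠ AffineMap.lineMap (pos t j) (pos (t + 1) j) s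

/-- For robots `0, 1, 2, 3` at `A, B, C, D`: the angle between the ray `BA` and the extension of
the segment `CB` beyond `B`. -/
def firstAngle (p : Config 4) : ℝ := InnerProductGeometry.angle (p 0 - p 1) (p 1 - p 2)

/-- For robots `0, 1, 2, 3` at `A, B, C, D`: the angle between the ray `CD` and the extension of
the segment `BC` beyond `C`. -/
def lastAngle (p : Config 4) : ℝ := InnerProductGeometry.angle (p 3 - p 2) (p 2 - p 1)

/-- Configuration (I): acute angles `θ₁ < θ₂`, where `BC` is at least as long as `AB` and `CD`. -/
def IsConfigurationI (p : Config 4) : Prop :=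
  0 < firstAngle p ∧ firstAngle p < lastAngle p ∧ lastAngle p < Real.pi / 2 ∧
    dist (p 0) (p 1) ≤ dist (p 1) (p 2) ∧ dist (p 2) (p 3) ≤ dist (p 1) (p 2)

/-- The problem Angle Equalization, posed on the configurations (I) whose visibility graph is
connected (no restriction under full visibility): without any collision and without any movement
of the robots at `B` and `C`, reach in finite time, and keep, a configuration in which both angles
are equal to the initial `θ₂`. -/
def angleEqualization (R : Team 4) (V : Visibility) : Problem 4 where
  init := {p | IsConfigurationI p ∧ (visibilityGraph R V p).Connected}
  correct := {pos | CollisionFree pos ∧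
    (∀ t, pos t 1 = pos 0 1 ∧ pos t 2 = pos 0 2) ∧
    ∃ T, (∀ t, T ≤ t → pos t = pos T) ∧
      firstAngle (pos T) = lastAngle (pos 0) ∧ lastAngle (pos T) = lastAngle (pos 0)}

/-- The team of robots with rigid movements and visibility radius `r`, without any agreement on
the local coordinate systems, which the adversary chooses afresh in every round. -/
def disorientedTeam (n : ℕ) (r : ℝ) (hr : 0 < r) : Team n where
  radius := r
  radius_pos := hr
  minMove := ⊤
  minMove_pos := ENNReal.zero_lt_top
  frames := Set.univ
  frames_nonempty := ⟨fun _ _ => ⟨LinearIsometryEquiv.refl ℝ Plane, 1, one_pos⟩, trivial⟩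

end MobileRobots

end

open scoped ENNReal

noncomputable section

namespace MobileRobots

open InnerProductGeometry ComplexConjugate

/-! With full visibility a robot can ignore whatever lies beyond `V_r`, which gives the inclusions
(`restrictView`). Strictness comes from Angle Equalization. Solvability: in a path `ABCD` with
obtuse inner angles and `BC` at least as long as the outer edges, the three edges are strictly
shorter than the other three distances. So the set of points determines the labelling up to reversal
(`IsObtusePath.eq_or_eq_rev`), and the order of the angles decides between the two. The first robot
slides parallel to `BC` until its angle is `θ₂`. Its target is the same from every point of the
slide and the order of the angles never reverses, so interruptions and idle rounds do no harm; once
the angles agree, no robot recognizes itself as the first. Impossibility: take `|BC| = V_r`. An end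
robot then sees at most its own neighbour, so both ends apply one common map to their positions
relative to their neighbours. The adversary chooses the axes so that this map commutes with
rotations while the neighbour is visible, and is radial once it is out of sight. If the map turned
visible robots by a nonzero angle, some start would lead in one round to a configuration in which
the ends have exchanged roles: either obliviousness then demands two different final angles, or the
directions are frozen at a wrong angle (`arg_image_eq_zero`). If it never turns them, the angles
never change at all (`not_solves_limited`). -/

/-- A path of four points with obtuse angles at the two inner points, whose middle segment is at
least as long as the outer ones. -/
structure IsObtusePath (p : Config 4) : Prop where
  inner_first : 0 < inner ℝ (p 0 - p 1) (p 1 - p 2)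
  inner_last : 0 < inner ℝ (p 3 - p 2) (p 2 - p 1)
  dist_first : dist (p 0) (p 1) ≤ dist (p 1) (p 2)
  dist_last : dist (p 2) (p 3) ≤ dist (p 1) (p 2)

theorem Plane.inner_eq (x y : Plane) : inner ℝ x y = x 0 * y 0 + x 1 * y 1 := by
  simp [PiLp.inner_apply, Fin.sum_univ_two, mul_comm]

theorem Plane.dist_le_dist_iff (a b c d : Plane) : dist a b ≤ dist c d ↔
    (a 0 - b 0) ^ 2 + (a 1 - b 1) ^ 2 ≤ (c 0 - d 0) ^ 2 + (c 1 - d 1) ^ 2 := by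
  rw [EuclideanSpace.dist_eq, EuclideanSpace.dist_eq, Real.sqrt_le_sqrt_iff (by positivity)]
  simp [Fin.sum_univ_two, Real.dist_eq, sq_abs]

theorem inner_pos_iff_angle_lt {x y : Plane} : 0 < inner ℝ x y ↔ angle x y < Real.pi / 2 := by
  rw [angle, Real.arccos_lt_pi_div_two]
  rcases eq_or_ne x 0 with rfl | hx
  · simp
  rcases eq_or_ne y 0 with rfl | hy
  · simp
  rw [lt_div_iff₀ (by positivity), zero_mul]

/-! ### Recognizing an obtuse path from its set of points. -/

namespace IsObtusePath

variable {p : Config 4}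

theorem injective (hp : IsObtusePath p) : Function.Injective p := by
  obtain ⟨h1, h2, h3, h4⟩ := hp
  simp only [Plane.inner_eq, Plane.dist_le_dist_iff, PiLp.sub_apply] at *
  have hne : ∀ i j : Fin 4, i < j → p i ≠ p j := by
    intro i j hij h
    have hx := congrArg (fun v : Plane => v 0) h
    have hy := congrArg (fun v : Plane => v 1) h
    have hxx := congrArg (fun x : ℝ => x ^ 2) hx
    simp only at hx hy
    fin_cases i <;> fin_cases j <;> simp at hij hx hy <;>
    · simp only [hx, hy] at *
      nlinarith
  intro i j h
  rcases lt_trichotomy i j with hij | hij | hij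
  · exact absurd h (hne i j hij)
  · exact hij
  · exact absurd h.symm (hne j i hij)

/-- The labelling of an obtuse path is determined by its set of points, up to reversal. -/
theorem eq_or_eq_rev {q : Config 4} (hp : IsObtusePath p) (hq : IsObtusePath q)
    (h : Set.range q = Set.range p) : q = p ∨ q = p ∘ Fin.rev := by
  have hqi := hq.injective
  have : ∀ i, ∃ j, p j = q i := fun i => by
    have : q i ∈ Set.range p := h ▸ Set.mem_range_self i
    exact this
  choose σ hσ using this
  have hσi : Function.Injective σ := fun i j hij => hqi (by rw [← hσ, ← hσ, hij])
  obtain rfl : q = p ∘ σ := funext fun i => (hσ i).symm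
  suffices (σ 1 = 1 ∧ σ 2 = 2 ∧ σ 0 = 0 ∧ σ 3 = 3) ∨ (σ 1 = 2 ∧ σ 2 = 1 ∧ σ 0 = 3 ∧ σ 3 = 0) by
    rcases this with ⟨h1, h2, h0, h3⟩ | ⟨h1, h2, h0, h3⟩
    · left; funext i; fin_cases i <;> simp [h0, h1, h2, h3]
    · right; funext i; fin_cases i <;> simp [h0, h1, h2, h3]
  have h01 := hσi.ne (show (0 : Fin 4) ≠ 1 by decide)
  have h02 := hσi.ne (show (0 : Fin 4) ≠ 2 by decide)
  have h03 := hσi.ne (show (0 : Fin 4) ≠ 3 by decide)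
  have h12 := hσi.ne (show (1 : Fin 4) ≠ 2 by decide)
  have h13 := hσi.ne (show (1 : Fin 4) ≠ 3 by decide)
  have h23 := hσi.ne (show (2 : Fin 4) ≠ 3 by decide)
  obtain ⟨a1, a2, a3, a4⟩ := hp
  obtain ⟨b1, b2, b3, b4⟩ := hq
  simp only [Plane.inner_eq, Plane.dist_le_dist_iff, PiLp.sub_apply, Function.comp] at *
  generalize hi : σ 0 = i at *
  generalize hj : σ 1 = j at *
  generalize hk : σ 2 = k at *
  generalize hl : σ 3 = l at *
  -- `AB` and `CD` are at most `BC`, which is strictly shorter than `AC`, `BD` and `AD`, so both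
  -- labellings have the same edges. These squares supply the nonlinear facts with which `linarith`
  -- refutes each of the other 22 permutations.
  have hR1 : 0 ≤ ((p 0 0 - p 1 0) - (p 3 0 - p 2 0)) ^ 2 + ((p 0 1 - p 1 1) - (p 3 1 - p 2 1)) ^ 2 :=
    by positivity
  have hR2 : 0 ≤ ((p 0 0 - p 1 0) + (p 3 0 - p 2 0)) ^ 2 + ((p 0 1 - p 1 1) + (p 3 1 - p 2 1)) ^ 2 :=
    by positivity
  have hW : 0 ≤ (p 0 0 - p 1 0) ^ 2 + (p 0 1 - p 1 1) ^ 2 := by positivity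
  have hV : 0 ≤ (p 3 0 - p 2 0) ^ 2 + (p 3 1 - p 2 1) ^ 2 := by positivity
  clear hσ h hqi hi hj hk hl hσi
  fin_cases i <;> fin_cases j <;>
    first
    | exact absurd rfl h01
    | (fin_cases k <;>
        first
        | exact absurd rfl h02
        | exact absurd rfl h12
        | (fin_cases l <;>
            first
            | exact absurd rfl h03
            | exact absurd rfl h13
            | exact absurd rfl h23
            | decide
            | (exfalso; simp at b1 b2 b3 b4; linarith)))

end IsObtusePath

/-! ### Coordinates of the first point relative to `BC`, and the slide. -/

/-- The distance of the first point from the perpendicular to `BC` at `B`, in units of `|BC|`. -/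
def offset (p : Config 4) : ℝ := inner ℝ (p 0 - p 1) (p 1 - p 2) / ‖p 1 - p 2‖ ^ 2

/-- The distance of the first point from the line `BC`, in units of `|BC|`. -/
def elevation (p : Config 4) : ℝ :=
  ‖p 0 - p 1 - offset p • (p 1 - p 2)‖ / ‖p 1 - p 2‖

/-- How far the first point has to move parallel to `BC`, in units of `|BC|`, until the first angle
equals the last one. -/
def gap (p : Config 4) : ℝ := offset p - elevation p / Real.tan (lastAngle p)

/-- The configuration after a move of the first robot parallel to `BC` by `τ|BC|`. -/
def slide (p : Config 4) (τ : ℝ) : Config 4 :=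
  Function.update p 0 (p 0 - τ • (p 1 - p 2))

@[simp] theorem slide_apply_zero (p : Config 4) (τ : ℝ) :
    slide p τ 0 = p 0 - τ • (p 1 - p 2) := by simp [slide]

@[simp] theorem slide_apply_of_ne (p : Config 4) (τ : ℝ) {i : Fin 4} (hi : i ≠ 0) :
    slide p τ i = p i := by simp [slide, hi]

@[simp] theorem slide_zero (p : Config 4) : slide p 0 = p := by simp [slide]

theorem slide_slide (p : Config 4) (σ τ : ℝ) : slide (slide p σ) τ = slide p (σ + τ) := by
  funext i
  by_cases hi : i = 0
  · subst hi; simp; module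
  · simp [hi]

theorem lastAngle_slide (p : Config 4) (τ : ℝ) : lastAngle (slide p τ) = lastAngle p := by
  simp [lastAngle]

theorem offset_slide {p : Config 4} (h : p 1 ≠ p 2) (τ : ℝ) :
    offset (slide p τ) = offset p - τ := by
  have h' : ‖p 1 - p 2‖ ≠ 0 := norm_ne_zero_iff.2 (sub_ne_zero.2 h)
  have : p 0 - τ • (p 1 - p 2) - p 1 = (p 0 - p 1) - τ • (p 1 - p 2) := by abel
  simp only [offset, slide_apply_zero, slide_apply_of_ne, ne_eq, Fin.reduceEq, not_false_eq_true,
    this]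
  rw [inner_sub_left, real_inner_smul_left, real_inner_self_eq_norm_sq]
  field_simp

theorem elevation_slide {p : Config 4} (h : p 1 ≠ p 2) (τ : ℝ) :
    elevation (slide p τ) = elevation p := by
  have : p 0 - τ • (p 1 - p 2) - p 1 - (offset p - τ) • (p 1 - p 2) =
      p 0 - p 1 - offset p • (p 1 - p 2) := by module
  rw [elevation, offset_slide h]
  simp [this, elevation]

/-- The remaining way shrinks by exactly the distance covered, so an interrupted robot later aims at
the same target. -/
theorem gap_slide {p : Config 4} (h : p 1 ≠ p 2) (τ : ℝ) : gap (slide p τ) = gap p - τ := by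
  rw [gap, offset_slide h, elevation_slide h, lastAngle_slide, gap]; ring

theorem ne_of_offset_pos {p : Config 4} (h : 0 < offset p) : p 1 ≠ p 2 := by
  rintro h'
  simp [offset, h'] at h

theorem inner_offset_eq_zero {p : Config 4} (h : p 1 ≠ p 2) :
    inner ℝ (p 1 - p 2) (p 0 - p 1 - offset p • (p 1 - p 2)) = 0 := by
  have h' : ‖p 1 - p 2‖ ≠ 0 := norm_ne_zero_iff.2 (sub_ne_zero.2 h)
  rw [inner_sub_right, real_inner_smul_right, real_inner_self_eq_norm_sq, offset,
    real_inner_comm]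
  field_simp
  ring

/-- Right triangle with legs `offset p` and `elevation p`; a slide changes only the first leg. -/
theorem firstAngle_eq_arctan {p : Config 4} (h : 0 < offset p) :
    firstAngle p = Real.arctan (elevation p / offset p) := by
  have h12 := ne_of_offset_pos h
  have h0 : offset p • (p 1 - p 2) ≠ 0 := smul_ne_zero h.ne' (sub_ne_zero.2 h12)
  have key := angle_add_eq_arctan_of_inner_eq_zero (x := offset p • (p 1 - p 2))
    (y := p 0 - p 1 - offset p • (p 1 - p 2))
    (by rw [real_inner_smul_left, inner_offset_eq_zero h12, mul_zero]) h0
  rw [add_sub_cancel, angle_smul_left_of_pos _ _ h, norm_smul, Real.norm_of_nonneg h.le,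
    angle_comm] at key
  rw [firstAngle, key, elevation, div_div, mul_comm]

theorem dist_sq_eq {p : Config 4} (h : p 1 ≠ p 2) :
    dist (p 0) (p 1) ^ 2 = (offset p ^ 2 + elevation p ^ 2) * dist (p 1) (p 2) ^ 2 := by
  have h' : ‖p 1 - p 2‖ ≠ 0 := norm_ne_zero_iff.2 (sub_ne_zero.2 h)
  have key := norm_add_sq_eq_norm_sq_add_norm_sq_of_inner_eq_zero (offset p • (p 1 - p 2))
    (p 0 - p 1 - offset p • (p 1 - p 2))
    (by rw [real_inner_smul_left, inner_offset_eq_zero h, mul_zero])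
  rw [add_sub_cancel, norm_smul, Real.norm_eq_abs] at key
  rw [dist_eq_norm, dist_eq_norm, elevation, pow_two, key, div_pow, add_mul,
    div_mul_cancel₀ _ (pow_ne_zero 2 h'), ← sq_abs (offset p)]
  ring

theorem offset_pos_iff {p : Config 4} :
    0 < offset p ↔ 0 < inner ℝ (p 0 - p 1) (p 1 - p 2) := by
  rcases eq_or_ne (p 1) (p 2) with h | h
  · simp [offset, h]
  · have h' : 0 < ‖p 1 - p 2‖ := norm_pos_iff.2 (sub_ne_zero.2 h)
    rw [offset, lt_div_iff₀ (by positivity), zero_mul]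

/-! ### Admissible configurations, the invariant of the algorithm. -/

/-- Configurations (I), with the difference that the two angles may also be equal. -/
structure IsAdmissible (p : Config 4) : Prop extends IsObtusePath p where
  elevation_pos : 0 < elevation p
  lastAngle_pos : 0 < lastAngle p
  gap_nonneg : 0 ≤ gap p

namespace IsAdmissible

variable {p : Config 4}

theorem offset_pos (hp : IsAdmissible p) : 0 < offset p := offset_pos_iff.2 hp.inner_first

theorem ne (hp : IsAdmissible p) : p 1 ≠ p 2 := ne_of_offset_pos hp.offset_pos

theorem lastAngle_lt (hp : IsAdmissible p) : lastAngle p < Real.pi / 2 :=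
  inner_pos_iff_angle_lt.1 hp.inner_last

theorem tan_pos (hp : IsAdmissible p) : 0 < Real.tan (lastAngle p) :=
  Real.tan_pos_of_pos_of_lt_pi_div_two hp.lastAngle_pos hp.lastAngle_lt

theorem firstAngle_lt_iff (hp : IsAdmissible p) : firstAngle p < lastAngle p ↔ 0 < gap p := by
  rw [← Real.arctan_tan (x := lastAngle p) (by linarith [hp.lastAngle_pos, Real.pi_pos])
    hp.lastAngle_lt, firstAngle_eq_arctan hp.offset_pos, Real.arctan_strictMono.lt_iff_lt, gap,
    sub_pos, div_lt_iff₀ hp.offset_pos, div_lt_iff₀ hp.tan_pos, mul_comm]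

theorem firstAngle_eq_iff (hp : IsAdmissible p) : firstAngle p = lastAngle p ↔ gap p = 0 := by
  rw [← Real.arctan_tan (x := lastAngle p) (by linarith [hp.lastAngle_pos, Real.pi_pos])
    hp.lastAngle_lt, firstAngle_eq_arctan hp.offset_pos, Real.arctan_injective.eq_iff, gap,
    sub_eq_zero, div_eq_iff hp.offset_pos.ne', eq_div_iff hp.tan_pos.ne', mul_comm, eq_comm]

theorem firstAngle_le (hp : IsAdmissible p) : firstAngle p ≤ lastAngle p := by
  rcases hp.gap_nonneg.lt_or_eq with h | h
  · exact (hp.firstAngle_lt_iff.2 h).le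
  · exact (hp.firstAngle_eq_iff.2 h.symm).le

theorem isConfigurationI_iff (hp : IsAdmissible p) : IsConfigurationI p ↔ 0 < gap p := by
  rw [← hp.firstAngle_lt_iff]
  refine ⟨fun h => h.2.1, fun h => ⟨?_, h, hp.lastAngle_lt, hp.dist_first, hp.dist_last⟩⟩
  rw [firstAngle_eq_arctan hp.offset_pos, ← Real.arctan_zero, Real.arctan_strictMono.lt_iff_lt]
  exact div_pos hp.elevation_pos hp.offset_pos

/-- Up to `gap p` the offset stays at least `elevation p / tan θ₂ > 0`, so the angle at `B` remains
obtuse, while `AB` only gets shorter. -/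
theorem slide (hp : IsAdmissible p) {τ : ℝ} (h0 : 0 ≤ τ) (h1 : τ ≤ gap p) :
    IsAdmissible (slide p τ) := by
  have ho : 0 < offset (MobileRobots.slide p τ) := by
    rw [offset_slide hp.ne]
    have : 0 < elevation p / Real.tan (lastAngle p) := div_pos hp.elevation_pos hp.tan_pos
    unfold gap at h1
    linarith
  have hne : MobileRobots.slide p τ 1 ≠ MobileRobots.slide p τ 2 := by simpa using hp.ne
  refine ⟨⟨offset_pos_iff.1 ho, by simpa using hp.inner_last, ?_, by simpa using hp.dist_last⟩,
    by simpa [elevation_slide hp.ne] using hp.elevation_pos,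
    by simpa [lastAngle_slide] using hp.lastAngle_pos, by rw [gap_slide hp.ne]; linarith⟩
  have hle : dist (MobileRobots.slide p τ 0) (MobileRobots.slide p τ 1) ≤ dist (p 0) (p 1) := by
    refine le_of_sq_le_sq ?_ dist_nonneg
    rw [dist_sq_eq hne, dist_sq_eq hp.ne, elevation_slide hp.ne, offset_slide hp.ne] at *
    simp only [slide_apply_of_ne, ne_eq, Fin.reduceEq, not_false_eq_true]
    gcongr
    linarith
  simpa using hle.trans hp.dist_first

end IsAdmissible

theorem IsConfigurationI.isObtusePath {p : Config 4} (hp : IsConfigurationI p) :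
    IsObtusePath p :=
  ⟨inner_pos_iff_angle_lt.2 (hp.2.1.trans hp.2.2.1), inner_pos_iff_angle_lt.2 hp.2.2.1,
    hp.2.2.2.1, hp.2.2.2.2⟩

theorem IsConfigurationI.isAdmissible {p : Config 4} (hp : IsConfigurationI p) :
    IsAdmissible p := by
  have ho := offset_pos_iff.2 hp.isObtusePath.inner_first
  have h1 := hp.1
  have h2 := hp.2.1
  have h3 : 0 < lastAngle p := h1.trans h2
  have ht := Real.tan_pos_of_pos_of_lt_pi_div_two h3 hp.2.2.1
  rw [← Real.arctan_tan (x := lastAngle p) (by linarith [Real.pi_pos]) hp.2.2.1,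
    firstAngle_eq_arctan ho, Real.arctan_strictMono.lt_iff_lt, div_lt_iff₀ ho, mul_comm,
    ← div_lt_iff₀ ht] at h2
  rw [firstAngle_eq_arctan ho, ← Real.arctan_zero, Real.arctan_strictMono.lt_iff_lt,
    lt_div_iff₀ ho, zero_mul] at h1
  exact ⟨hp.isObtusePath, h1, h3, sub_nonneg.2 h2.le⟩

/-! ### Local coordinates -/

theorem Frame.toLocal_sub (F : Frame) (c x y : Plane) :
    F.toLocal c x - F.toLocal c y = F.scale • F.axes (x - y) := by
  simp [Frame.toLocal, ← smul_sub, ← map_sub]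

theorem Frame.angle_smul_axes (F : Frame) (x y : Plane) :
    angle (F.scale • F.axes x) (F.scale • F.axes y) = angle x y := by
  rw [angle_smul_smul F.scale_pos.ne']
  exact F.axes.toLinearIsometry.angle_map x y

theorem Frame.dist_toLocal (F : Frame) (c x y : Plane) :
    dist (F.toLocal c x) (F.toLocal c y) = F.scale * dist x y := by
  rw [dist_eq_norm, F.toLocal_sub, norm_smul, Real.norm_of_nonneg F.scale_pos.le,
    F.axes.norm_map, dist_eq_norm]

theorem Frame.toGlobal_zero (F : Frame) (c : Plane) : F.toGlobal c 0 = c := by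
  simp [Frame.toGlobal]

theorem Frame.toLocal_self (F : Frame) (c : Plane) : F.toLocal c c = 0 := by
  simp [Frame.toLocal]

section LocalCoordinates

variable (F : Frame) (c : Plane) (p : Config 4)

theorem firstAngle_toLocal : firstAngle (F.toLocal c ∘ p) = firstAngle p := by
  simp [firstAngle, F.toLocal_sub, F.angle_smul_axes, -map_sub]

theorem lastAngle_toLocal : lastAngle (F.toLocal c ∘ p) = lastAngle p := by
  simp [lastAngle, F.toLocal_sub, F.angle_smul_axes, -map_sub]

theorem isConfigurationI_toLocal : IsConfigurationI (F.toLocal c ∘ p) ↔ IsConfigurationI p := by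
  simp [IsConfigurationI, firstAngle_toLocal, lastAngle_toLocal, F.dist_toLocal,
    mul_le_mul_iff_right₀ F.scale_pos]

theorem isObtusePath_toLocal (hp : IsObtusePath p) : IsObtusePath (F.toLocal c ∘ p) := by
  obtain ⟨h1, h2, h3, h4⟩ := hp
  refine ⟨?_, ?_, ?_, ?_⟩
  · simpa [inner_pos_iff_angle_lt, F.toLocal_sub, F.angle_smul_axes, -map_sub] using h1
  · simpa [inner_pos_iff_angle_lt, F.toLocal_sub, F.angle_smul_axes, -map_sub] using h2
  · simpa [F.dist_toLocal, F.scale_pos] using h3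
  · simpa [F.dist_toLocal, F.scale_pos] using h4

theorem offset_toLocal : offset (F.toLocal c ∘ p) = offset p := by
  have := F.scale_pos.ne'
  simp only [offset, Function.comp, F.toLocal_sub, norm_smul, F.axes.norm_map, mul_pow,
    real_inner_smul_left, real_inner_smul_right, F.axes.inner_map_map, Real.norm_eq_abs, sq_abs]
  field_simp

theorem elevation_toLocal : elevation (F.toLocal c ∘ p) = elevation p := by
  have := F.scale_pos.ne'
  rw [elevation, offset_toLocal]
  simp only [Function.comp, F.toLocal_sub]
  rw [smul_comm, ← smul_sub, ← map_smul, ← map_sub, norm_smul, norm_smul, F.axes.norm_map,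
    F.axes.norm_map, mul_div_mul_left _ _ (by simpa using this), elevation]

theorem gap_toLocal : gap (F.toLocal c ∘ p) = gap p := by
  rw [gap, offset_toLocal, elevation_toLocal, lastAngle_toLocal, gap]

theorem slide_toLocal (τ : ℝ) : slide (F.toLocal c ∘ p) τ = F.toLocal c ∘ slide p τ := by
  funext i
  by_cases hi : i = 0
  · subst hi
    simp only [slide_apply_zero, Function.comp, F.toLocal_sub]
    simp only [Frame.toLocal]
    rw [show p 0 - τ • (p 1 - p 2) - c = p 0 - c - τ • (p 1 - p 2) by abel, map_sub F.axes (p 0 - c),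
      map_smul, smul_sub, smul_comm]
  · simp [hi]

end LocalCoordinates

/-! ### The algorithm and its executions under full visibility. -/

theorem snapshot_full {n : ℕ} (R : Team n) (F : Frame) (p : Config n) (i : Fin n) :
    snapshot R .full F p i = Set.range (F.toLocal (p i) ∘ p) := by
  ext x
  simp [snapshot, Sees, eq_comm]

open Classical in
/-- The algorithm for Angle Equalization: a robot that recognizes itself as the first robot of a
configuration (I) moves parallel to `BC` until both angles are equal; other robots stay. -/
def equalize (s : Set Plane) : Plane :=
  if h : ∃ p : Config 4, IsConfigurationI p ∧ p 0 = 0 ∧ Set.range p = s then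
    -- The choice is harmless: for snapshots of admissible configurations only one labelling
    -- qualifies, see `destination_equalize`.
    slide h.choose (gap h.choose) 0
  else 0

theorem destination_equalize (R : Team 4) (F : Frame) {p : Config 4} (hp : IsAdmissible p)
    (i : Fin 4) : destination R .full (fun _ => equalize) F p i = slide p (gap p) i := by
  rw [destination, snapshot_full]
  set q := F.toLocal (p i) ∘ p with hq
  have hqp : IsObtusePath q := isObtusePath_toLocal F _ p hp.toIsObtusePath
  have hqi : q i = 0 := F.toLocal_self _
  have hunique : ∀ p' : Config 4, IsConfigurationI p' → Set.range p' = Set.range q → p' = q := by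
    intro p' hp' hr
    rcases hqp.eq_or_eq_rev hp'.isObtusePath hr with h | h
    · exact h
    -- The reversed labelling would put the strictly smaller angle at the last robot, against
    -- `hp.firstAngle_le`.
    · exfalso
      have h1 : firstAngle p' = lastAngle q := by rw [h]; rfl
      have h2 : lastAngle p' = firstAngle q := by rw [h]; rfl
      rw [lastAngle_toLocal] at h1
      rw [firstAngle_toLocal] at h2
      have h3 := hp'.2.1
      rw [h1, h2] at h3
      exact absurd hp.firstAngle_le (not_le.2 h3)
  by_cases hex : ∃ p' : Config 4, IsConfigurationI p' ∧ p' 0 = 0 ∧ Set.range p' = Set.range q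
  · have hc := hex.choose_spec
    have he := hunique _ hc.1 hc.2.2
    rw [equalize, dif_pos hex]
    rw [he] at hc ⊢
    obtain rfl : i = 0 := hqp.injective (hqi.trans hc.2.1.symm)
    rw [gap_toLocal, slide_toLocal, Function.comp, F.toGlobal_toLocal]
  · rw [equalize, dif_neg hex, F.toGlobal_zero]
    by_cases hi : i = 0
    · subst hi
      have hng : ¬ 0 < gap p := fun h => hex
        ⟨q, (isConfigurationI_toLocal F _ p).2 (hp.isConfigurationI_iff.2 h), hqi, rfl⟩
      rw [le_antisymm (not_lt.1 hng) hp.gap_nonneg, slide_zero]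
    · rw [slide_apply_of_ne _ _ hi]

theorem Moves.eq_of_self {δ : ℝ≥0∞} {p q : Plane} (h : Moves δ p p q) : q = p := by
  simpa using h.1

/-- One round of `equalize` slides the first robot towards its destination. -/
theorem exists_slide_of_moves {δ : ℝ≥0∞} {p : Config 4} (hp : IsAdmissible p) {q : Plane}
    (h : Moves δ (p 0) (slide p (gap p) 0) q) :
    ∃ τ, 0 ≤ τ ∧ τ ≤ gap p ∧ q = slide p τ 0 ∧
      (τ = gap p ∨ δ ≤ ENNReal.ofReal (τ * dist (p 1) (p 2))) := by
  obtain ⟨h1, h2⟩ := h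
  rw [segment_eq_image_lineMap] at h1
  obtain ⟨s, ⟨hs0, hs1⟩, rfl⟩ := h1
  have hg := hp.gap_nonneg
  have hs : AffineMap.lineMap (p 0) (slide p (gap p) 0) s = slide p (s * gap p) 0 := by
    rw [AffineMap.lineMap_apply_module', slide_apply_zero, slide_apply_zero]
    module
  refine ⟨s * gap p, by positivity, mul_le_of_le_one_left hg hs1, hs, ?_⟩
  rw [hs] at h2
  rcases h2 with h2 | h2
  · left
    have h3 : (s * gap p) • (p 1 - p 2) = gap p • (p 1 - p 2) := by simpa using h2
    exact smul_left_injective ℝ (sub_ne_zero.2 hp.ne) h3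
  · right
    rw [edist_dist] at h2
    convert h2 using 2
    rw [slide_apply_zero, dist_self_sub_right, norm_smul, dist_eq_norm,
      Real.norm_of_nonneg (by positivity)]

/-- In an execution of `equalize` the first robot slides, and each of its activations completes the
slide or advances it by a fixed amount. -/
theorem exists_slides {R : Team 4} {S : Scheduler} {pos : ℕ → Config 4}
    (h0 : IsAdmissible (pos 0)) (hex : IsExecution (fun _ => equalize) S .full R pos) :
    ∃ τ : ℕ → ℝ, τ 0 = 0 ∧ Monotone τ ∧ (∀ t, τ t ≤ gap (pos 0)) ∧
      (∀ t, pos t = slide (pos 0) (τ t)) ∧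
      ∃ ε > 0, ∀ t, ∃ t', t ≤ t' ∧ (τ (t' + 1) = gap (pos 0) ∨ τ t' + ε ≤ τ (t' + 1)) := by
  obtain ⟨act, hact, F, -, hex⟩ := hex
  have hd : 0 < dist (pos 0 1) (pos 0 2) := dist_pos.2 h0.ne
  have step : ∀ t σ, 0 ≤ σ → σ ≤ gap (pos 0) → pos t = slide (pos 0) σ →
      ∃ σ', σ ≤ σ' ∧ σ' ≤ gap (pos 0) ∧ pos (t + 1) = slide (pos 0) σ' ∧
        (0 ∈ act t → σ' = gap (pos 0) ∨
          R.minMove ≤ ENNReal.ofReal ((σ' - σ) * dist (pos 0 1) (pos 0 2))) := by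
    intro t σ hσ0 hσ1 hpos
    have hadm : IsAdmissible (pos t) := hpos ▸ h0.slide hσ0 hσ1
    have hgap : gap (pos t) = gap (pos 0) - σ := by rw [hpos, gap_slide h0.ne]
    have hmove : ∀ i, i ∈ act t →
        Moves R.minMove (pos t i) (slide (pos t) (gap (pos t)) i) (pos (t + 1) i) := by
      intro i hi
      have := (hex t i).1 hi
      rwa [destination_equalize R _ hadm] at this
    have hother : ∀ i, i ≠ 0 → pos (t + 1) i = pos t i := by
      intro i hi
      by_cases hia : i ∈ act t
      · have := hmove i hia
        rw [slide_apply_of_ne _ _ hi] at this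
        exact this.eq_of_self
      · exact (hex t i).2 hia
    have hzero : ∃ τ, 0 ≤ τ ∧ τ ≤ gap (pos t) ∧ pos (t + 1) 0 = slide (pos t) τ 0 ∧
        (0 ∈ act t → τ = gap (pos t) ∨
          R.minMove ≤ ENNReal.ofReal (τ * dist (pos t 1) (pos t 2))) := by
      by_cases hia : (0 : Fin 4) ∈ act t
      · obtain ⟨τ, h1, h2, h3, h4⟩ := exists_slide_of_moves hadm (hmove 0 hia)
        exact ⟨τ, h1, h2, h3, fun _ => h4⟩
      · exact ⟨0, le_rfl, hadm.gap_nonneg, by rw [slide_zero]; exact (hex t 0).2 hia,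
          fun h => absurd h hia⟩
    obtain ⟨τ, h1, h2, h3, h4⟩ := hzero
    refine ⟨σ + τ, by linarith, by linarith, ?_, fun hia => ?_⟩
    · rw [← slide_slide, ← hpos]
      funext i
      by_cases hi : i = 0
      · rw [hi, h3]
      · rw [slide_apply_of_ne _ _ hi, hother i hi]
    · rcases h4 hia with h | h
      · left; linarith
      · right
        simpa [hpos] using h
  have hpos : ∀ t, ∃ σ, 0 ≤ σ ∧ σ ≤ gap (pos 0) ∧ pos t = slide (pos 0) σ := by
    intro t
    induction t with
    | zero => exact ⟨0, le_rfl, h0.gap_nonneg, (slide_zero _).symm⟩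
    | succ t ih =>
      obtain ⟨σ, h1, h2, h3⟩ := ih
      obtain ⟨σ', h4, h5, h6, -⟩ := step t σ h1 h2 h3
      exact ⟨σ', h1.trans h4, h5, h6⟩
  -- The slide parameter can be read off from `gap`, so the parameters chosen for consecutive rounds
  -- fit together.
  have hinj : ∀ σ τ, slide (pos 0) σ = slide (pos 0) τ → σ = τ := fun σ τ h => by
    have := gap_slide h0.ne σ
    rw [h, gap_slide h0.ne] at this
    linarith
  choose τ hτ0 hτ1 hτ using hpos
  have step' : ∀ t, τ t ≤ τ (t + 1) ∧ (0 ∈ act t → τ (t + 1) = gap (pos 0) ∨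
          R.minMove ≤ ENNReal.ofReal ((τ (t + 1) - τ t) * dist (pos 0 1) (pos 0 2))) := by
    intro t
    obtain ⟨σ', h1, -, h3, h4⟩ := step t (τ t) (hτ0 t) (hτ1 t) (hτ t)
    obtain rfl : τ (t + 1) = σ' := hinj _ _ ((hτ (t + 1)).symm.trans h3)
    exact ⟨h1, h4⟩
  refine ⟨τ, hinj _ _ (by rw [← hτ, slide_zero]), monotone_nat_of_le_succ fun t => (step' t).1,
    hτ1, hτ, ?_⟩
  -- Rigid movements have `minMove = ⊤`; any positive real then serves as a lower bound.
  obtain ⟨δ, hδ0, hδ⟩ : ∃ δ : ℝ, 0 < δ ∧ ENNReal.ofReal δ ≤ R.minMove := by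
    rcases eq_or_ne R.minMove ⊤ with h | h
    · exact ⟨1, one_pos, by simp [h]⟩
    · exact ⟨R.minMove.toReal, ENNReal.toReal_pos R.minMove_pos.ne' h, by
        rw [ENNReal.ofReal_toReal h]⟩
  refine ⟨δ / dist (pos 0 1) (pos 0 2), div_pos hδ0 hd, fun t => ?_⟩
  obtain ⟨t', ht, hta⟩ : ∃ t', t ≤ t' ∧ (0 : Fin 4) ∈ act t' := by
    cases S with
    | fsynch => exact ⟨t, le_rfl, by rw [hact t]; trivial⟩
    | ssynch => exact hact 0 t
  refine ⟨t', ht, ((step' t').2 hta).imp_right fun h => ?_⟩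
  have h5 := (ENNReal.ofReal_le_ofReal_iff
    (mul_nonneg (sub_nonneg.2 (step' t').1) dist_nonneg)).1 (hδ.trans h)
  have := (div_le_iff₀ hd).2 h5
  linarith

theorem exists_eq_of_progress {τ : ℕ → ℝ} {g ε : ℝ} (hmono : Monotone τ) (hle : ∀ t, τ t ≤ g)
    (hε : 0 < ε) (h : ∀ t, ∃ t', t ≤ t' ∧ (τ (t' + 1) = g ∨ τ t' + ε ≤ τ (t' + 1))) :
    ∃ T, τ T = g := by
  by_contra! hne
  have hk : ∀ k : ℕ, ∃ t, τ 0 + k * ε ≤ τ t := by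
    intro k
    induction k with
    | zero => exact ⟨0, by simp⟩
    | succ k ih =>
      obtain ⟨t, ht⟩ := ih
      obtain ⟨t', h1, h2 | h2⟩ := h t
      · exact absurd h2 (hne _)
      · refine ⟨t' + 1, ?_⟩
        have := hmono h1
        push_cast
        linarith
  obtain ⟨k, hk'⟩ := exists_nat_gt ((g - τ 0) / ε)
  obtain ⟨t, ht⟩ := hk k
  rw [div_lt_iff₀ hε] at hk'
  linarith [hle t]

/-- The executions of `equalize` from a configuration (I) are correct. -/
theorem correct_of_isExecution_equalize {R : Team 4} {S : Scheduler} {V : Visibility}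
    {pos : ℕ → Config 4} (h0 : IsConfigurationI (pos 0))
    (hex : IsExecution (fun _ => equalize) S .full R pos) :
    pos ∈ (angleEqualization R V).correct ∧ ∀ t i, i ≠ 0 → pos t i = pos 0 i := by
  have hadm := h0.isAdmissible
  obtain ⟨τ, hτ0, hmono, hle, hτ, ε, hε, hprog⟩ := exists_slides hadm hex
  have hfix : ∀ t i, i ≠ 0 → pos t i = pos 0 i := fun t i hi => by
    rw [hτ, slide_apply_of_ne _ _ hi]
  obtain ⟨T, hT⟩ := exists_eq_of_progress hmono hle hε hprog
  have hnonneg : ∀ t, 0 ≤ τ t := fun t => hτ0 ▸ hmono t.zero_le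
  refine ⟨⟨?_, fun t => ⟨hfix t 1 (by decide), hfix t 2 (by decide)⟩, T, ?_, ?_, ?_⟩, hfix⟩
  · intro t i j hij s ⟨hs0, hs1⟩
    -- At every instant of the round the configuration is itself a slide of the initial one, hence
    -- an obtuse path, hence injective.
    set σ := AffineMap.lineMap (τ t) (τ (t + 1)) s with hσ
    have hline : ∀ i, AffineMap.lineMap (pos t i) (pos (t + 1) i) s = slide (pos 0) σ i := by
      intro i
      rw [hτ t, hτ (t + 1)]
      by_cases hi : i = 0
      · subst hi
        simp only [slide_apply_zero, AffineMap.lineMap_apply_module', smul_eq_mul, hσ]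
        module
      · simp [hi]
    have hσm : σ ∈ Set.Icc (τ t) (τ (t + 1)) := by
      rw [← segment_eq_Icc (hmono t.le_succ), segment_eq_image_lineMap]
      exact Set.mem_image_of_mem _ ⟨hs0, hs1⟩
    rw [hline, hline]
    exact (hadm.slide ((hnonneg t).trans hσm.1) (hσm.2.trans (hle _))).injective.ne hij
  · intro t ht
    rw [hτ t, hτ T, le_antisymm (hle t) (hT ▸ hmono ht), hT]
  · rw [hτ T, hT, (hadm.slide hadm.gap_nonneg le_rfl).firstAngle_eq_iff.2
      (by rw [gap_slide hadm.ne, sub_self]), lastAngle_slide]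
  · rw [hτ T, lastAngle_slide]

/-! ### Full visibility simulates limited visibility. -/

/-- The algorithm that simulates limited visibility by ignoring all robots beyond the radius. -/
def restrictView (f : Algorithm) : Algorithm := fun v s => f v {x ∈ s | ‖x‖ ≤ v}

theorem Frame.norm_toLocal (F : Frame) (p q : Plane) :
    ‖F.toLocal p q‖ = F.scale * dist p q := by
  rw [Frame.toLocal, norm_smul, F.axes.norm_map, Real.norm_of_nonneg F.scale_pos.le, dist_comm,
    dist_eq_norm]

/-- The radius and the local distances are scaled by the same unit, so the filter keeps exactly the
robots within `V_r`. -/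
theorem destination_restrictView {n : ℕ} (R : Team n) (f : Algorithm) (F : Frame) (p : Config n)
    (i : Fin n) :
    destination R .full (restrictView f) F p i = destination R .limited f F p i := by
  have : {x ∈ snapshot R .full F p i | ‖x‖ ≤ F.scale * R.radius} = snapshot R .limited F p i := by
    ext x
    constructor
    · rintro ⟨⟨j, -, rfl⟩, h⟩
      rw [F.norm_toLocal, mul_le_mul_iff_right₀ F.scale_pos] at h
      exact ⟨j, h, rfl⟩
    · rintro ⟨j, h, rfl⟩
      refine ⟨⟨j, trivial, rfl⟩, ?_⟩
      rw [F.norm_toLocal, mul_le_mul_iff_right₀ F.scale_pos]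
      exact h
  rw [destination, destination, restrictView, this]

theorem visibilityGraph_le_full {n : ℕ} (R : Team n) (V : Visibility) (p : Config n) :
    visibilityGraph R V p ≤ visibilityGraph R .full p := by
  intro i j h
  exact ⟨h.1, Or.inl trivial⟩

theorem notLessPowerful_full_limited (S : Scheduler) : NotLessPowerful S .full S .limited := by
  rintro n R P ⟨hc, f, hf⟩
  refine ⟨fun p hp => (hc p hp).mono (visibilityGraph_le_full R _ p), restrictView f, ?_⟩
  intro pos h0 hex
  refine hf pos h0 ?_
  simpa only [IsExecution, destination_restrictView] using hex

/-- `V` affects only which initial configurations are admitted, so one algorithm serves both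
versions of the problem. -/
theorem angleEqualization_mem_task_full (R : Team 4) (V : Visibility) (S : Scheduler) :
    angleEqualization R V ∈ Task S .full R :=
  ⟨fun p hp => hp.2.mono (visibilityGraph_le_full R V p), fun _ => equalize,
    fun _ h0 hex => (correct_of_isExecution_equalize h0.1 hex).1⟩

/-- Fully synchronous executions are also semi-synchronous ones, so impossibility need only be shown
for `fsynch`. -/
theorem Solves.fsynch {n : ℕ} {f : Algorithm} {S : Scheduler} {V : Visibility} {R : Team n}
    {P : Problem n} (h : Solves f S V R P) : Solves f .fsynch V R P := by
  rintro pos h0 ⟨act, hact, hex⟩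
  refine h pos h0 ⟨act, ?_, hex⟩
  cases S with
  | fsynch => exact hact
  | ssynch => exact fun i t => ⟨t, le_rfl, by rw [hact t]; trivial⟩

/-! ### Teams without agreement on the local coordinate systems -/

/-- The execution in which the adversary chooses the local coordinate systems by a rule that
depends on the current configuration. -/
def run {n : ℕ} (R : Team n) (V : Visibility) (f : Algorithm) (Φ : Config n → Fin n → Frame)
    (p : Config n) : ℕ → Config n
  | 0 => p
  | t + 1 => fun i => destination R V f (Φ (run R V f Φ p t) i) (run R V f Φ p t) i

theorem isExecution_run {n : ℕ} {r : ℝ} (hr : 0 < r) (V : Visibility) (f : Algorithm)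
    (Φ : Config n → Fin n → Frame) (p : Config n) :
    IsExecution f .fsynch V (disorientedTeam n r hr) (run (disorientedTeam n r hr) V f Φ p) :=
  ⟨fun _ => Set.univ, fun _ => rfl, fun t => Φ (run (disorientedTeam n r hr) V f Φ p t), trivial,
    fun _ _ => ⟨fun _ => ⟨right_mem_segment _ _ _, Or.inl rfl⟩, fun h => absurd trivial h⟩⟩

theorem snapshot_comp {n : ℕ} (R : Team n) (V : Visibility) (F : Frame) (p : Config n)
    (σ : Equiv.Perm (Fin n)) (i : Fin n) :
    snapshot R V F (p ∘ σ) i = snapshot R V F p (σ i) := by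
  ext x
  exact σ.exists_congr_left.trans (by simp [snapshot])

/-- Obliviousness allows dropping the first round, anonymity allows renaming the robots. No
constraint on the frames has to be respected, since all of them are admissible. -/
theorem IsExecution.shift_comp {n : ℕ} {r : ℝ} {hr : 0 < r} {V : Visibility} {f : Algorithm}
    {pos : ℕ → Config n} (h : IsExecution f .fsynch V (disorientedTeam n r hr) pos)
    (σ : Equiv.Perm (Fin n)) :
    IsExecution f .fsynch V (disorientedTeam n r hr) fun t => pos (t + 1) ∘ σ := by
  obtain ⟨act, hact, F, -, hex⟩ := h
  refine ⟨fun _ => Set.univ, fun _ => rfl, fun t i => F (t + 1) (σ i), trivial, fun t i =>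
    ⟨fun _ => ?_, fun h => absurd trivial h⟩⟩
  have := (hex (t + 1) (σ i)).1 (by rw [hact]; trivial)
  rwa [destination, snapshot_comp]

/-! ### Configurations in complex coordinates -/

/-- The plane with complex coordinates. -/
def ofComplex : ℂ ≃ₗᵢ[ℝ] Plane := Complex.orthonormalBasisOneI.repr

/-- The reflection that exchanges the outward directions at the points `B` and `C`. -/
def outward : ℂ ≃ₗᵢ[ℝ] ℂ := Complex.conjLIE.trans (LinearIsometryEquiv.neg ℝ)

@[simp] theorem outward_apply (z : ℂ) : outward z = -conj z := rfl

/-- The configuration with `|BC| = r` in which the first and the last robot have the positions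
`w₁`, `w₂` relative to `B`, `C`, in complex coordinates whose positive real axis points outwards. -/
def pathConfig (r : ℝ) (w₁ w₂ : ℂ) : Config 4 :=
  -- The summand `0 +` gives both ends the shape `M + ofComplex (e w)` that `destination_eq_advance`
  -- expects, so that `rfl` matches it.
  ![0 + ofComplex (outward w₁), 0, ofComplex r, ofComplex r + ofComplex w₂]

theorem angle_ofComplex (x y : ℂ) : angle (ofComplex x) (ofComplex y) = angle x y :=
  ofComplex.toLinearIsometry.angle_map x y

theorem firstAngle_pathConfig {r : ℝ} (hr : 0 < r) {w₁ : ℂ} (h : w₁ ≠ 0) (w₂ : ℂ) :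
    firstAngle (pathConfig r w₁ w₂) = |w₁.arg| := by
  have hr' : (r : ℂ) ≠ 0 := by exact_mod_cast hr.ne'
  have hout : outward (r : ℂ) = -r := by simp
  have : firstAngle (pathConfig r w₁ w₂) = angle (ofComplex (outward w₁)) (ofComplex (outward r)) := by
    rw [hout]
    simp [firstAngle, pathConfig, -outward_apply]
  rw [this, angle_ofComplex]
  refine (outward.toLinearIsometry.angle_map w₁ r).trans ?_
  rw [Complex.angle_eq_abs_arg h hr', div_eq_mul_inv, ← Complex.ofReal_inv,
    Complex.arg_mul_real (inv_pos.2 hr)]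

theorem lastAngle_pathConfig {r : ℝ} (hr : 0 < r) (w₁ : ℂ) {w₂ : ℂ} (h : w₂ ≠ 0) :
    lastAngle (pathConfig r w₁ w₂) = |w₂.arg| := by
  have hr' : (r : ℂ) ≠ 0 := by exact_mod_cast hr.ne'
  have : lastAngle (pathConfig r w₁ w₂) = angle (ofComplex w₂) (ofComplex r) := by
    simp [lastAngle, pathConfig]
  rw [this, angle_ofComplex, Complex.angle_eq_abs_arg h hr', div_eq_mul_inv, ← Complex.ofReal_inv,
    Complex.arg_mul_real (inv_pos.2 hr)]

/-- The first and the last robot see their neighbours, and the angles are positive, acute and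
different, where the second one is the larger. -/
structure IsStart (r : ℝ) (w₁ w₂ : ℂ) : Prop where
  norm_first : ‖w₁‖ ≤ r
  norm_last : ‖w₂‖ ≤ r
  re_first : 0 < w₁.re
  re_last : 0 < w₂.re
  arg_pos : 0 < |w₁.arg|
  arg_lt : |w₁.arg| < |w₂.arg|

theorem ne_zero_of_re_pos {w : ℂ} (h : 0 < w.re) : w ≠ 0 := by
  rintro rfl
  simp at h

theorem mem_init_of_dist_le {r : ℝ} (hr : 0 < r) {p : Config 4} (hp : IsConfigurationI p)
    (h : dist (p 1) (p 2) ≤ r) :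
    p ∈ (angleEqualization (disorientedTeam 4 r hr) .limited).init := by
  refine ⟨hp, ?_⟩
  set G := visibilityGraph (disorientedTeam 4 r hr) .limited p
  have h01 : G.Adj 0 1 := ⟨by decide, Or.inl (hp.2.2.2.1.trans h)⟩
  have h12 : G.Adj 1 2 := ⟨by decide, Or.inl h⟩
  have h23 : G.Adj 2 3 := ⟨by decide, Or.inl (hp.2.2.2.2.trans h)⟩
  have hreach : ∀ i, G.Reachable 0 i := by
    intro i
    fin_cases i
    · exact SimpleGraph.Reachable.refl _
    · exact h01.reachable
    · exact h01.reachable.trans h12.reachable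
    · exact (h01.reachable.trans h12.reachable).trans h23.reachable
  exact ⟨fun i j => (hreach i).symm.trans (hreach j)⟩

theorem dist_pathConfig_zero_one (r : ℝ) (w₁ w₂ : ℂ) :
    dist (pathConfig r w₁ w₂ 0) (pathConfig r w₁ w₂ 1) = ‖w₁‖ := by
  simp [pathConfig, -outward_apply]

theorem dist_pathConfig_one_two {r : ℝ} (hr : 0 < r) (w₁ w₂ : ℂ) :
    dist (pathConfig r w₁ w₂ 1) (pathConfig r w₁ w₂ 2) = r := by
  simp [pathConfig, abs_of_pos hr]

theorem dist_pathConfig_two_three (r : ℝ) (w₁ w₂ : ℂ) :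
    dist (pathConfig r w₁ w₂ 2) (pathConfig r w₁ w₂ 3) = ‖w₂‖ := by
  simp [pathConfig]

theorem IsStart.mem_init {r : ℝ} (hr : 0 < r) {w₁ w₂ : ℂ} (h : IsStart r w₁ w₂) :
    pathConfig r w₁ w₂ ∈ (angleEqualization (disorientedTeam 4 r hr) .limited).init := by
  refine mem_init_of_dist_le hr ?_ (dist_pathConfig_one_two hr _ _).le
  rw [IsConfigurationI, firstAngle_pathConfig hr (ne_zero_of_re_pos h.re_first),
    lastAngle_pathConfig hr _ (ne_zero_of_re_pos h.re_last), dist_pathConfig_zero_one,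
    dist_pathConfig_one_two hr, dist_pathConfig_two_three]
  exact ⟨h.arg_pos, h.arg_lt, Complex.abs_arg_lt_pi_div_two_iff.2 (Or.inl h.re_last),
    h.norm_first, h.norm_last⟩

theorem firstAngle_comp_rev (p : Config 4) : firstAngle (p ∘ Fin.revPerm) = lastAngle p := rfl

theorem lastAngle_comp_rev (p : Config 4) : lastAngle (p ∘ Fin.revPerm) = firstAngle p := rfl

theorem IsStart.mem_init_rev {r : ℝ} (hr : 0 < r) {w₁ w₂ : ℂ} (h : IsStart r w₂ w₁) :
    pathConfig r w₁ w₂ ∘ Fin.revPerm ∈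
      (angleEqualization (disorientedTeam 4 r hr) .limited).init := by
  have h01 : dist ((pathConfig r w₁ w₂ ∘ Fin.revPerm) 0) ((pathConfig r w₁ w₂ ∘ Fin.revPerm) 1) =
      ‖w₂‖ := (dist_comm _ _).trans (dist_pathConfig_two_three r w₁ w₂)
  have h12 : dist ((pathConfig r w₁ w₂ ∘ Fin.revPerm) 1) ((pathConfig r w₁ w₂ ∘ Fin.revPerm) 2) =
      r := (dist_comm _ _).trans (dist_pathConfig_one_two hr w₁ w₂)
  have h23 : dist ((pathConfig r w₁ w₂ ∘ Fin.revPerm) 2) ((pathConfig r w₁ w₂ ∘ Fin.revPerm) 3) =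
      ‖w₁‖ := (dist_comm _ _).trans (dist_pathConfig_zero_one r w₁ w₂)
  refine mem_init_of_dist_le hr ?_ h12.le
  rw [IsConfigurationI, firstAngle_comp_rev, lastAngle_comp_rev,
    firstAngle_pathConfig hr (ne_zero_of_re_pos h.re_last),
    lastAngle_pathConfig hr _ (ne_zero_of_re_pos h.re_first), h01, h12, h23]
  exact ⟨h.arg_pos, h.arg_lt, Complex.abs_arg_lt_pi_div_two_iff.2 (Or.inl h.re_last),
    h.norm_first, h.norm_last⟩

theorem eventually_angles {R : Team 4} {V : Visibility} {pos : ℕ → Config 4}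
    (h : pos ∈ (angleEqualization R V).correct) : ∃ T, ∀ t, T ≤ t →
      firstAngle (pos t) = lastAngle (pos 0) ∧ lastAngle (pos t) = lastAngle (pos 0) := by
  obtain ⟨-, -, T, hT, h1, h2⟩ := h
  exact ⟨T, fun t ht => by rw [hT t ht]; exact ⟨h1, h2⟩⟩

/-! ### The adversary -/

/-- Local coordinates with unit `1` and with axes given by a linear isometry, which maps local to
global coordinates. -/
def frameOf (e : ℂ ≃ₗᵢ[ℝ] ℂ) : Frame where
  axes := (ofComplex.symm.trans e.symm).trans ofComplex
  scale := 1
  scale_pos := one_pos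

theorem toGlobal_frameOf (e : ℂ ≃ₗᵢ[ℝ] ℂ) (p x : Plane) :
    (frameOf e).toGlobal p x = p + ofComplex (e (ofComplex.symm x)) := by
  simp [frameOf, Frame.toGlobal]

theorem toLocal_frameOf (e : ℂ ≃ₗᵢ[ℝ] ℂ) (p : Plane) (z : ℂ) :
    (frameOf e).toLocal p (p + ofComplex (e z)) = ofComplex z := by
  simp [frameOf, Frame.toLocal]

theorem exists_circle_mul_eq {y z : ℂ} (h : ‖y‖ = ‖z‖) : ∃ c : Circle, (c : ℂ) * y = z := by
  rcases eq_or_ne y 0 with rfl | hy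
  · exact ⟨1, by simpa [eq_comm] using h⟩
  · refine ⟨⟨z / y, mem_sphere_zero_iff_norm.2 ?_⟩, div_mul_cancel₀ z hy⟩
    rw [norm_div, h, div_self (h ▸ norm_ne_zero_iff.2 hy)]

section Adversary

variable (f : Algorithm) (r : ℝ)

/-- The local destination of a robot that sees at most one other robot, at the relative
position `-‖w‖`. -/
def reaction (w : ℂ) : ℂ :=
  ofComplex.symm (f r ({0} ∪ {x | ‖w‖ ≤ r ∧ x = ofComplex (-‖w‖)}))

theorem reaction_congr {w w' : ℂ} (h : ‖w‖ = ‖w'‖) : reaction f r w = reaction f r w' := by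
  rw [reaction, reaction, h]

/-- If the neighbour is visible, the axes are aligned with it. Otherwise the snapshot contains only
the robot itself, and the rotation is free to direct the resulting move along `w`. -/
theorem exists_turn (w : ℂ) : ∃ c : Circle, (‖w‖ ≤ r → (c : ℂ) * ‖w‖ = w) ∧
    (r < ‖w‖ → 0 < r → (c : ℂ) * reaction f r w = (‖reaction f r w‖ / ‖w‖ : ℝ) * w) := by
  rcases le_or_gt ‖w‖ r with h | h
  · obtain ⟨c, hc⟩ := exists_circle_mul_eq (y := (‖w‖ : ℂ)) (z := w) (by simp)
    exact ⟨c, fun _ => hc, fun h' => absurd h' (not_lt.2 h)⟩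
  · rcases eq_or_ne w 0 with rfl | hw
    · exact ⟨1, fun h' => by simp, fun h1 h2 => absurd h1 (by simpa using h2.le)⟩
    obtain ⟨c, hc⟩ := exists_circle_mul_eq (y := reaction f r w)
      (z := (‖reaction f r w‖ / ‖w‖ : ℝ) * w) (by
        have : ‖w‖ ≠ 0 := norm_ne_zero_iff.2 hw
        rw [norm_mul, Complex.norm_real, norm_div, norm_norm, norm_norm, div_mul_cancel₀ _ this])
    exact ⟨c, fun h' => absurd h (not_lt.2 h'), fun _ _ => hc⟩

/-- The rotation of the local coordinate system that the adversary chooses: the real axis points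
away from the neighbour, if that is visible; otherwise the robot moves away from its neighbour. -/
def turn (w : ℂ) : Circle := (exists_turn f r w).choose

/-- The relative position after a round. -/
def advance (w : ℂ) : ℂ := w + turn f r w * reaction f r w

variable {r}

theorem turn_mul_norm {w : ℂ} (h : ‖w‖ ≤ r) : (turn f r w : ℂ) * ‖w‖ = w :=
  (exists_turn f r w).choose_spec.1 h

theorem advance_of_le {w : ℂ} (h : ‖w‖ ≤ r) :
    advance f r w = turn f r w * (‖w‖ + reaction f r w) := by
  rw [mul_add, turn_mul_norm f h, advance]

theorem advance_of_lt (hr : 0 < r) {w : ℂ} (h : r < ‖w‖) :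
    advance f r w = (1 + ‖reaction f r w‖ / ‖w‖ : ℝ) * w := by
  have := (exists_turn f r w).choose_spec.2 h hr
  rw [advance, turn, this]
  push_cast
  ring

/-- A robot that sees nobody but its neighbour at `M`, or nobody at all if `M` is out of sight. -/
theorem destination_eq_advance (hr : 0 < r) {n : ℕ} {p : Config n} {i : Fin n} {M : Plane}
    {e : ℂ ≃ₗᵢ[ℝ] ℂ} {w : ℂ} (hi : p i = M + ofComplex (e w))
    (hview : ∀ x, (∃ j, dist (p i) (p j) ≤ r ∧ p j = x) ↔ x = p i ∨ ‖w‖ ≤ r ∧ x = M) :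
    destination (disorientedTeam n r hr) .limited f (frameOf ((rotation (turn f r w)).trans e)) p i =
      M + ofComplex (e (advance f r w)) := by
  set F := frameOf ((rotation (turn f r w)).trans e) with hF
  have hM : ‖w‖ ≤ r → F.toLocal (p i) M = ofComplex (-‖w‖) := by
    intro h
    have : M = p i + ofComplex ((rotation (turn f r w)).trans e (-‖w‖)) := by
      have h' := turn_mul_norm f h
      simp only [LinearIsometryEquiv.trans_apply, rotation_apply, mul_neg, h', hi]
      simp
    rw [this, hF, toLocal_frameOf]
  have hsnap : snapshot (disorientedTeam n r hr) .limited F p i =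
      {0} ∪ {x | ‖w‖ ≤ r ∧ x = ofComplex (-‖w‖)} := by
    ext x
    constructor
    · rintro ⟨j, hj, rfl⟩
      rcases (hview (p j)).1 ⟨j, hj, rfl⟩ with h | ⟨h1, h2⟩
      · left; rw [h]; exact F.toLocal_self _
      · right; rw [h2]; exact ⟨h1, hM h1⟩
    · rintro (h | ⟨h1, h2⟩)
      · exact ⟨i, (dist_self (p i)).le.trans hr.le, by rw [F.toLocal_self]; exact h⟩
      · obtain ⟨j, hj, hjM⟩ := (hview M).2 (Or.inr ⟨h1, rfl⟩)
        exact ⟨j, hj, by rw [hjM, hM h1, h2]⟩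
  have hscale : F.scale * (disorientedTeam n r hr).radius = r := one_mul r
  rw [destination, hsnap, hscale, hF, toGlobal_frameOf, ← reaction, hi, advance]
  simp only [LinearIsometryEquiv.trans_apply, rotation_apply, map_add]
  abel

variable (r) in
/-- The local coordinate systems that the adversary chooses in a configuration. -/
def adversary (p : Config 4) (i : Fin 4) : Frame :=
  if i = 0 then
    frameOf ((rotation (turn f r (outward (ofComplex.symm (p 0 - p 1))))).trans outward)
  -- The inner robots get these frames too; their frames are immaterial, since a correct algorithm
  -- never moves them.
  else
    frameOf ((rotation (turn f r (ofComplex.symm (p 3 - p 2)))).trans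
      (LinearIsometryEquiv.refl ℝ ℂ))

theorem lt_norm_of_lt_re {z : ℂ} (h : r < z.re) : r < ‖z‖ :=
  h.trans_le ((le_abs_self _).trans (Complex.abs_re_le_norm z))

theorem dist_pathConfig_zero_two (r : ℝ) (w₁ w₂ : ℂ) :
    dist (pathConfig r w₁ w₂ 0) (pathConfig r w₁ w₂ 2) = ‖w₁ + r‖ := by
  have : outward w₁ - r = outward (w₁ + r) := by simp; ring
  simp only [pathConfig, dist_eq_norm, Matrix.cons_val, zero_add]
  rw [← map_sub, ofComplex.norm_map, this, outward.norm_map]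

theorem dist_pathConfig_zero_three (r : ℝ) (w₁ w₂ : ℂ) :
    dist (pathConfig r w₁ w₂ 0) (pathConfig r w₁ w₂ 3) = ‖w₁ + r + conj w₂‖ := by
  have : outward w₁ - (r + w₂) = outward (w₁ + r + conj w₂) := by simp; ring
  simp only [pathConfig, dist_eq_norm, Matrix.cons_val, zero_add]
  rw [← map_add, ← map_sub, ofComplex.norm_map, this, outward.norm_map]

theorem dist_pathConfig_one_three (r : ℝ) (w₁ w₂ : ℂ) :
    dist (pathConfig r w₁ w₂ 1) (pathConfig r w₁ w₂ 3) = ‖w₂ + r‖ := by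
  simp only [pathConfig, dist_eq_norm, Matrix.cons_val, zero_sub, norm_neg]
  rw [← map_add, ofComplex.norm_map, add_comm]

/-- With `|BC| = r` and both ends pointing outwards, `C` and `D` are farther than `r` from `A`: only
`B` can be in view. -/
theorem destination_zero (hr : 0 < r) {w₁ w₂ : ℂ} (h₁ : 0 < w₁.re) (h₂ : 0 < w₂.re) :
    destination (disorientedTeam 4 r hr) .limited f (adversary f r (pathConfig r w₁ w₂) 0)
      (pathConfig r w₁ w₂) 0 = 0 + ofComplex (outward (advance f r w₁)) := by
  have hw : outward (ofComplex.symm (pathConfig r w₁ w₂ 0 - pathConfig r w₁ w₂ 1)) = w₁ := by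
    simp [pathConfig]
  rw [adversary, if_pos rfl, hw]
  refine destination_eq_advance f hr rfl fun x => ?_
  have h02 : ¬ dist (pathConfig r w₁ w₂ 0) (pathConfig r w₁ w₂ 2) ≤ r := by
    rw [dist_pathConfig_zero_two, not_le]
    exact lt_norm_of_lt_re (by simpa using h₁)
  have h03 : ¬ dist (pathConfig r w₁ w₂ 0) (pathConfig r w₁ w₂ 3) ≤ r := by
    rw [dist_pathConfig_zero_three, not_le]
    exact lt_norm_of_lt_re (by simp; linarith)
  rw [← dist_pathConfig_zero_one r w₁ w₂]
  constructor
  · rintro ⟨j, hj, rfl⟩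
    fin_cases j
    exacts [Or.inl rfl, Or.inr ⟨hj, rfl⟩, absurd hj h02, absurd hj h03]
  · rintro (rfl | ⟨h, rfl⟩)
    exacts [⟨0, (dist_self _).le.trans hr.le, rfl⟩, ⟨1, h, rfl⟩]

theorem destination_three (hr : 0 < r) {w₁ w₂ : ℂ} (h₁ : 0 < w₁.re) (h₂ : 0 < w₂.re) :
    destination (disorientedTeam 4 r hr) .limited f (adversary f r (pathConfig r w₁ w₂) 3)
      (pathConfig r w₁ w₂) 3 = ofComplex r + ofComplex (advance f r w₂) := by
  have hw : ofComplex.symm (pathConfig r w₁ w₂ 3 - pathConfig r w₁ w₂ 2) = w₂ := by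
    simp [pathConfig]
  rw [adversary, if_neg (by decide), hw]
  refine destination_eq_advance f hr rfl fun x => ?_
  have h30 : ¬ dist (pathConfig r w₁ w₂ 3) (pathConfig r w₁ w₂ 0) ≤ r := by
    rw [dist_comm, dist_pathConfig_zero_three, not_le]
    exact lt_norm_of_lt_re (by simp; linarith)
  have h31 : ¬ dist (pathConfig r w₁ w₂ 3) (pathConfig r w₁ w₂ 1) ≤ r := by
    rw [dist_comm, dist_pathConfig_one_three, not_le]
    exact lt_norm_of_lt_re (by simpa using h₂)
  have h32 : dist (pathConfig r w₁ w₂ 3) (pathConfig r w₁ w₂ 2) = ‖w₂‖ := by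
    rw [dist_comm, dist_pathConfig_two_three]
  rw [← h32]
  constructor
  · rintro ⟨j, hj, rfl⟩
    fin_cases j
    exacts [absurd hj h30, absurd hj h31, Or.inr ⟨hj, rfl⟩, Or.inl rfl]
  · rintro (rfl | ⟨h, rfl⟩)
    exacts [⟨3, (dist_self _).le.trans hr.le, rfl⟩, ⟨2, h, rfl⟩]

end Adversary

/-! ### The dynamics of the two ends against the adversary. -/

/-- The execution against the adversary from a configuration given in complex coordinates. -/
def adversaryRun (f : Algorithm) {r : ℝ} (hr : 0 < r) (w₁ w₂ : ℂ) : ℕ → Config 4 :=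
  run (disorientedTeam 4 r hr) .limited f (adversary f r) (pathConfig r w₁ w₂)

variable {f : Algorithm} {r : ℝ} {hr : 0 < r}

theorem adversaryRun_zero (w₁ w₂ : ℂ) : adversaryRun f hr w₁ w₂ 0 = pathConfig r w₁ w₂ := rfl

theorem adversaryRun_mem_correct
    (hf : Solves f .fsynch .limited (disorientedTeam 4 r hr)
      (angleEqualization (disorientedTeam 4 r hr) .limited))
    {w₁ w₂ : ℂ} (h : IsStart r w₁ w₂) :
    adversaryRun f hr w₁ w₂ ∈ (angleEqualization (disorientedTeam 4 r hr) .limited).correct :=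
  hf _ (h.mem_init hr) (isExecution_run hr _ _ _ _)

/-- The ends move by `advance`. What `B` and `C` compute need not be known: correctness of `f`
forbids them to move. -/
theorem adversaryRun_succ
    (hf : Solves f .fsynch .limited (disorientedTeam 4 r hr)
      (angleEqualization (disorientedTeam 4 r hr) .limited))
    {w₁ w₂ : ℂ} (h : IsStart r w₁ w₂) {t : ℕ} {v₁ v₂ : ℂ}
    (ht : adversaryRun f hr w₁ w₂ t = pathConfig r v₁ v₂) (h₁ : 0 < v₁.re) (h₂ : 0 < v₂.re) :
    adversaryRun f hr w₁ w₂ (t + 1) = pathConfig r (advance f r v₁) (advance f r v₂) := by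
  have hd : ∀ i, adversaryRun f hr w₁ w₂ (t + 1) i = destination (disorientedTeam 4 r hr) .limited f
      (adversary f r (pathConfig r v₁ v₂) i) (pathConfig r v₁ v₂) i := fun i => by
    rw [← ht, adversaryRun, run]
  obtain ⟨hc₁, hc₂⟩ := (adversaryRun_mem_correct hf h).2.1 (t + 1)
  have h0 := (hd 0).trans (destination_zero f hr h₁ h₂)
  have h3 := (hd 3).trans (destination_three f hr h₁ h₂)
  have hB : ∀ u₁ u₂, pathConfig r u₁ u₂ 1 = 0 := fun _ _ => rfl
  have hC : ∀ u₁ u₂, pathConfig r u₁ u₂ 2 = ofComplex r := fun _ _ => rfl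
  rw [adversaryRun_zero, hB] at hc₁
  rw [adversaryRun_zero, hC] at hc₂
  generalize adversaryRun f hr w₁ w₂ (t + 1) = q at *
  funext i
  fin_cases i
  exacts [h0, hc₁, hc₂, h3]

/-- Relative positions in `K` keep their direction forever, whence the angles do not change. -/
theorem angles_eq_of_invariant
    (hf : Solves f .fsynch .limited (disorientedTeam 4 r hr)
      (angleEqualization (disorientedTeam 4 r hr) .limited))
    {w₁ w₂ : ℂ} (h : IsStart r w₁ w₂) {K : Set ℂ}
    (hK : ∀ w ∈ K, ∃ c : ℝ, 0 < c ∧ advance f r w = c * w ∧ advance f r w ∈ K)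
    {t : ℕ} {v₁ v₂ : ℂ} (ht : adversaryRun f hr w₁ w₂ t = pathConfig r v₁ v₂)
    (h₁ : 0 < v₁.re) (h₂ : 0 < v₂.re) (hK₁ : v₁ ∈ K) (hK₂ : v₂ ∈ K) :
    |v₁.arg| = |w₂.arg| ∧ |v₂.arg| = |w₂.arg| := by
  have key : ∀ k, ∃ u₁ ∈ K, ∃ u₂ ∈ K, adversaryRun f hr w₁ w₂ (t + k) = pathConfig r u₁ u₂ ∧
      (0 < u₁.re ∧ u₁.arg = v₁.arg) ∧ (0 < u₂.re ∧ u₂.arg = v₂.arg) := by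
    intro k
    induction k with
    | zero => exact ⟨v₁, hK₁, v₂, hK₂, ht, ⟨h₁, rfl⟩, ⟨h₂, rfl⟩⟩
    | succ k ih =>
      obtain ⟨u₁, hu₁, u₂, hu₂, hk, ⟨a1, a2⟩, ⟨b1, b2⟩⟩ := ih
      obtain ⟨c, hc, hca, hcK⟩ := hK u₁ hu₁
      obtain ⟨d, hd, hda, hdK⟩ := hK u₂ hu₂
      refine ⟨_, hcK, _, hdK, adversaryRun_succ hf h hk a1 b1, ?_, ?_⟩
      · rw [hca, Complex.re_ofReal_mul, Complex.arg_real_mul _ hc]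
        exact ⟨mul_pos hc a1, a2⟩
      · rw [hda, Complex.re_ofReal_mul, Complex.arg_real_mul _ hd]
        exact ⟨mul_pos hd b1, b2⟩
  obtain ⟨T, hT⟩ := eventually_angles (adversaryRun_mem_correct hf h)
  obtain ⟨u₁, -, u₂, -, hk, ⟨a1, a2⟩, ⟨b1, b2⟩⟩ := key T
  have hT' := hT (t + T) (Nat.le_add_left _ _)
  have h0 : lastAngle (adversaryRun f hr w₁ w₂ 0) = |w₂.arg| :=
    lastAngle_pathConfig hr _ (ne_zero_of_re_pos h.re_last)
  rwa [hk, h0, firstAngle_pathConfig hr (ne_zero_of_re_pos a1),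
    lastAngle_pathConfig hr _ (ne_zero_of_re_pos b1), a2, b2] at hT'

/-- A robot that has lost its neighbour recedes radially or stays, so it never sees it again and
keeps its direction. -/
theorem advance_of_lt_norm (hr : 0 < r) {w : ℂ} (h : r < ‖w‖) :
    ∃ c : ℝ, 0 < c ∧ advance f r w = c * w ∧ r < ‖advance f r w‖ := by
  have h0 : 0 ≤ ‖reaction f r w‖ / ‖w‖ := by positivity
  refine ⟨_, by positivity, advance_of_lt f hr h, ?_⟩
  rw [advance_of_lt f hr h, norm_mul, Complex.norm_real, Real.norm_of_nonneg (by positivity)]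
  nlinarith [norm_nonneg w]

/-! ### A correct algorithm cannot turn the ends, and therefore does not exist. -/

/-- The point with polar coordinates `a`, `θ`. -/
def polar (a θ : ℝ) : ℂ := a * Complex.exp (θ * Complex.I)

theorem norm_polar {a : ℝ} (ha : 0 ≤ a) (θ : ℝ) : ‖polar a θ‖ = a := by
  rw [polar, norm_mul, Complex.norm_exp_ofReal_mul_I, mul_one, Complex.norm_real,
    Real.norm_of_nonneg ha]

theorem arg_polar {a θ : ℝ} (ha : 0 < a) (hθ : |θ| < Real.pi) : (polar a θ).arg = θ := by
  rw [polar, Complex.arg_real_mul _ ha, Complex.exp_mul_I,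
    Complex.arg_cos_add_sin_mul_I ⟨(abs_lt.1 hθ).1, (abs_lt.1 hθ).2.le⟩]

theorem re_polar_pos {a θ : ℝ} (ha : 0 < a) (hθ : |θ| < Real.pi / 2) : 0 < (polar a θ).re := by
  rw [polar, Complex.re_ofReal_mul, Complex.exp_ofReal_mul_I_re]
  exact mul_pos ha (Real.cos_pos_of_mem_Ioo (abs_lt.1 hθ))

theorem isStart_polar {a θ₁ θ₂ : ℝ} (ha : 0 < a) (har : a ≤ r) (h0 : 0 < |θ₁|) (h1 : |θ₁| < |θ₂|)
    (h2 : |θ₂| < Real.pi / 2) : IsStart r (polar a θ₁) (polar a θ₂) := by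
  have hpi := Real.pi_pos
  exact ⟨(norm_polar ha.le _).le.trans har, (norm_polar ha.le _).le.trans har,
    re_polar_pos ha (h1.trans h2), re_polar_pos ha h2, by rwa [arg_polar ha (by linarith)],
    by rwa [arg_polar ha (by linarith), arg_polar ha (by linarith)]⟩

/-- The relative position that a robot at the relative position `a > 0` reaches in one round. -/
def image (f : Algorithm) (r a : ℝ) : ℂ := a + reaction f r a

/-- Inside the visible disc the round is rotation-equivariant, so its values on the positive real
axis determine it. -/
theorem advance_eq_image {w : ℂ} (h : ‖w‖ ≤ r) :
    advance f r w = turn f r w * image f r ‖w‖ := by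
  rw [advance_of_le f h, image, reaction_congr f r (w := w) (w' := (‖w‖ : ℂ)) (by simp)]

theorem turn_polar {a θ : ℝ} (ha : 0 < a) (har : a ≤ r) :
    (turn f r (polar a θ) : ℂ) = Complex.exp (θ * Complex.I) := by
  have hn := norm_polar ha.le θ
  have := turn_mul_norm f (hn.le.trans har)
  rw [hn, polar, mul_comm] at this
  exact mul_left_cancel₀ (by exact_mod_cast ha.ne') this

theorem advance_polar {a θ : ℝ} (ha : 0 < a) (har : a ≤ r) :
    advance f r (polar a θ) = polar ‖image f r a‖ (θ + (image f r a).arg) := by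
  have hn := norm_polar ha.le θ
  rw [advance_eq_image (hn.le.trans har), hn, turn_polar ha har, polar]
  conv_lhs => rw [← Complex.norm_mul_exp_arg_mul_I (image f r a)]
  push_cast
  rw [add_mul, Complex.exp_add]
  ring

/-- A robot does not move to or through the position of its neighbour: that is a collision. -/
theorem image_mem_slitPlane
    (hf : Solves f .fsynch .limited (disorientedTeam 4 r hr)
      (angleEqualization (disorientedTeam 4 r hr) .limited))
    {a : ℝ} (ha : 0 < a) (har : a ≤ r) : image f r a ∈ Complex.slitPlane := by
  rw [Complex.mem_slitPlane_iff_not_le_zero]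
  intro hle
  obtain ⟨b, hb, hab⟩ : ∃ b : ℝ, 0 ≤ b ∧ image f r a = -(b : ℂ) := by
    obtain ⟨h1, h2⟩ := Complex.le_def.1 hle
    exact ⟨-(image f r a).re, by simpa using h1, Complex.ext (by simp) (by simpa using h2)⟩
  have hpi := Real.pi_pos
  have hstart : IsStart r (polar a (Real.pi / 6)) (polar a (Real.pi / 4)) := by
    refine isStart_polar ha har ?_ ?_ ?_ <;> simp only [abs_of_pos hpi, abs_div, Nat.abs_ofNat] <;>
      linarith
  -- The robot starts at distance `a` from `B` and ends at distance `b` on the other side, so it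
  -- passes through `B` at time `a / (a + b)`.
  have hcol := (adversaryRun_mem_correct hf hstart).1 0 0 1 (by decide) (a / (a + b))
    ⟨by positivity, (div_le_one (by positivity)).2 (by linarith)⟩
  rw [adversaryRun_succ hf hstart (t := 0) rfl hstart.re_first hstart.re_last] at hcol
  apply hcol
  have hadv : advance f r (polar a (Real.pi / 6)) = -((b / a : ℝ) • polar a (Real.pi / 6)) := by
    have hn := norm_polar ha.le (Real.pi / 6)
    have ha' : (a : ℂ) ≠ 0 := by exact_mod_cast ha.ne'
    rw [advance_eq_image (hn.le.trans har), hn, turn_polar ha har, hab, polar, Complex.real_smul]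
    push_cast
    field_simp
  have hz : a / (a + b) * (-(b / a) - 1) + 1 = 0 := by
    have : a + b ≠ 0 := by positivity
    field_simp
    ring
  simp only [adversaryRun, run, pathConfig, Matrix.cons_val, AffineMap.lineMap_apply_module',
    zero_add, sub_self, smul_zero, hadv, map_smul, ← neg_smul]
  generalize ofComplex (outward (polar a (Real.pi / 6))) = x
  rw [show (a / (a + b)) • (-(b / a) • x - x) + x = (a / (a + b) * (-(b / a) - 1) + 1) • x by
    module, hz, zero_smul]

/-- Robots that see only their neighbours do not turn around them. -/
theorem arg_image_eq_zero
    (hf : Solves f .fsynch .limited (disorientedTeam 4 r hr)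
      (angleEqualization (disorientedTeam 4 r hr) .limited))
    {a : ℝ} (ha : 0 < a) (har : a ≤ r) : (image f r a).arg = 0 := by
  have hslit := image_mem_slitPlane hf ha har
  have hρ : 0 < ‖image f r a‖ := norm_pos_iff.2 (Complex.slitPlane_ne_zero hslit)
  have hα : |(image f r a).arg| < Real.pi := by
    rw [abs_lt]
    exact ⟨Complex.neg_pi_lt_arg _,
      lt_of_le_of_ne (Complex.arg_le_pi _) (Complex.mem_slitPlane_iff_arg.1 hslit).1⟩
  by_contra hne
  set α := (image f r a).arg with hαdef
  set β := |α| with hβ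
  have hβ0 : 0 < β := abs_pos.2 hne
  obtain ⟨s, hs, hsα⟩ : ∃ s : ℝ, |s| = 1 ∧ α = s * β := by
    rcases abs_cases α with ⟨h, -⟩ | ⟨h, -⟩
    · exact ⟨1, by simp, by rw [hβ, h]; ring⟩
    · exact ⟨-1, by simp, by rw [hβ, h]; ring⟩
  -- Starting angles with `β / 2 < t₁ < t₂ < min β (π / 2)`, on the side opposite to the turn,
  -- become `β - t₁ > β - t₂ > 0`: their order is reversed, and both are below `β / 2`, hence acute
  -- and different from `t₂`. The interval is nonempty because `β < π`.
  obtain ⟨t₁, ht₁, ht₁'⟩ := exists_between (show β / 2 < min β (Real.pi / 2) from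
    lt_min (by linarith) (by linarith))
  obtain ⟨t₂, ht₂, ht₂'⟩ := exists_between ht₁'
  obtain ⟨ht₂β, ht₂π⟩ := lt_min_iff.1 ht₂'
  have habs : ∀ x, 0 < x → |s * x| = x := fun x hx => by rw [abs_mul, hs, one_mul, abs_of_pos hx]
  have habs' : ∀ x, 0 < x → |-(s * x)| = x := fun x hx => by rw [abs_neg, habs x hx]
  have hstart : IsStart r (polar a (-(s * t₁))) (polar a (-(s * t₂))) := by
    refine isStart_polar ha har ?_ ?_ ?_ <;> (try rw [habs' t₁ (by linarith)]) <;>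
      (try rw [habs' t₂ (by linarith)]) <;> linarith
  have hstep : ∀ t, advance f r (polar a (-(s * t))) = polar ‖image f r a‖ (s * (β - t)) :=
    fun t => by
      rw [advance_polar ha har, ← hαdef, hsα]
      congr 1
      ring
  have hone := adversaryRun_succ hf hstart (t := 0) rfl hstart.re_first hstart.re_last
  rw [hstep, hstep] at hone
  have hd₁ : |s * (β - t₁)| = β - t₁ := habs _ (by linarith)
  have hd₂ : |s * (β - t₂)| = β - t₂ := habs _ (by linarith)
  have hre₁ : 0 < (polar ‖image f r a‖ (s * (β - t₁))).re :=
    re_polar_pos hρ (by rw [hd₁]; linarith)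
  have hre₂ : 0 < (polar ‖image f r a‖ (s * (β - t₂))).re :=
    re_polar_pos hρ (by rw [hd₂]; linarith)
  have hargt₂ : |(polar a (-(s * t₂))).arg| = t₂ := by
    rw [arg_polar ha] <;> rw [habs' t₂ (by linarith)]
    linarith
  have harg₁ : |(polar ‖image f r a‖ (s * (β - t₁))).arg| = β - t₁ := by
    rw [arg_polar hρ] <;> rw [hd₁]
    linarith
  rcases le_or_gt ‖image f r a‖ r with hle | hlt
  -- The new configuration, read backwards, is again an initial one, with target `β - t₁`; the
  -- original execution has target `t₂`.
  · have hstart' : IsStart r (polar ‖image f r a‖ (s * (β - t₂)))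
        (polar ‖image f r a‖ (s * (β - t₁))) := by
      refine isStart_polar hρ hle ?_ ?_ ?_ <;> (try rw [hd₁]) <;> (try rw [hd₂]) <;> linarith
    have hc := hf (fun t => adversaryRun f hr _ _ (t + 1) ∘ Fin.revPerm)
      (by rw [hone]; exact hstart'.mem_init_rev hr)
      ((isExecution_run hr _ _ _ _).shift_comp _)
    obtain ⟨T, hT⟩ := eventually_angles hc
    obtain ⟨T', hT'⟩ := eventually_angles (adversaryRun_mem_correct hf hstart)
    have e1 := (hT (max T T') (le_max_left _ _)).1
    have e2 := (hT' (max T T' + 1) ((le_max_right _ _).trans (Nat.le_succ _))).2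
    have e3 : lastAngle (adversaryRun f hr (polar a (-(s * t₁))) (polar a (-(s * t₂))) 0) = t₂ :=
      (lastAngle_pathConfig hr _ (ne_zero_of_re_pos hstart.re_last)).trans hargt₂
    simp only [firstAngle_comp_rev, lastAngle_comp_rev] at e1
    rw [e2, e3, hone, firstAngle_pathConfig hr (ne_zero_of_re_pos hre₁), harg₁] at e1
    linarith
  -- Both ends are now out of sight of their neighbours, so the first angle stays `β - t₁` and never
  -- becomes `t₂`.
  · have hK := angles_eq_of_invariant hf hstart (K := {w | r < ‖w‖})
      (fun w hw => advance_of_lt_norm hr hw) hone hre₁ hre₂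
      (by simpa [norm_polar hρ.le] using hlt) (by simpa [norm_polar hρ.le] using hlt)
    rw [harg₁, hargt₂] at hK
    linarith [hK.1]

theorem not_solves_limited (f : Algorithm) {r : ℝ} (hr : 0 < r) (S : Scheduler) :
    ¬ Solves f S .limited (disorientedTeam 4 r hr)
      (angleEqualization (disorientedTeam 4 r hr) .limited) := by
  intro hS
  have hf := hS.fsynch
  have hpi := Real.pi_pos
  have hstart : IsStart r (polar r (Real.pi / 6)) (polar r (Real.pi / 4)) := by
    refine isStart_polar hr le_rfl ?_ ?_ ?_ <;>
      simp only [abs_of_pos hpi, abs_div, Nat.abs_ofNat] <;> linarith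
  -- Visible or not, a robot away from its neighbour keeps its direction: within the radius `image`
  -- is a positive real, beyond it the motion is radial. So the different initial angles persist.
  have hinv : ∀ w ∈ ({0}ᶜ : Set ℂ),
      ∃ c : ℝ, 0 < c ∧ advance f r w = c * w ∧ advance f r w ∈ ({0}ᶜ : Set ℂ) := by
    intro w hw
    have hn : 0 < ‖w‖ := norm_pos_iff.2 hw
    suffices ∃ c : ℝ, 0 < c ∧ advance f r w = c * w by
      obtain ⟨c, hc, h⟩ := this
      refine ⟨c, hc, h, ?_⟩
      rw [h]
      exact mul_ne_zero (by exact_mod_cast hc.ne') hw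
    rcases le_or_gt ‖w‖ r with hle | hlt
    · have hpos : 0 < ‖image f r ‖w‖‖ :=
        norm_pos_iff.2 (Complex.slitPlane_ne_zero (image_mem_slitPlane hf hn hle))
      have him : image f r ‖w‖ = (‖image f r ‖w‖‖ : ℂ) := by
        conv_lhs => rw [← Complex.norm_mul_exp_arg_mul_I (image f r ‖w‖),
          arg_image_eq_zero hf hn hle]
        simp
      refine ⟨‖image f r ‖w‖‖ / ‖w‖, by positivity, ?_⟩
      have hn' : (‖w‖ : ℂ) ≠ 0 := by exact_mod_cast hn.ne'
      have ht := turn_mul_norm f hle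
      calc advance f r w = turn f r w * image f r ‖w‖ := advance_eq_image hle
        _ = turn f r w * ‖image f r ‖w‖‖ := congrArg _ him
        _ = (‖image f r ‖w‖‖ / ‖w‖ : ℝ) * (turn f r w * ‖w‖) := by push_cast; field_simp
        _ = (‖image f r ‖w‖‖ / ‖w‖ : ℝ) * w := by rw [ht]
    · obtain ⟨c, hc, h, -⟩ := advance_of_lt_norm (f := f) hr hlt
      exact ⟨c, hc, h⟩
  have := angles_eq_of_invariant hf hstart hinv (t := 0) rfl hstart.re_first hstart.re_last
    (ne_zero_of_re_pos hstart.re_first) (ne_zero_of_re_pos hstart.re_last)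
  exact hstart.arg_lt.ne this.1

theorem morePowerful_full_limited (S : Scheduler) : MorePowerful S .full S .limited :=
  ⟨notLessPowerful_full_limited S, 4, disorientedTeam 4 1 one_pos, _,
    angleEqualization_mem_task_full _ .limited S,
    fun h => h.2.elim fun f hf => not_solves_limited f one_pos S hf⟩

end MobileRobots

end

theorem mainTheorem9 :
    -- full visibility is more powerful than limited visibility, under FSYNCH and SSYNCH
    MobileRobots.MorePowerful .fsynch .full .fsynch .limited ∧
    MobileRobots.MorePowerful .ssynch .full .ssynch .limited ∧
    -- one algorithm, which ignores the radius, solves Angle Equalization with full visibility for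
    -- every team of four robots, by moving only the first robot
    (∃ g : Set MobileRobots.Plane → MobileRobots.Plane,
      ∀ (R : MobileRobots.Team 4) (S : MobileRobots.Scheduler),
        MobileRobots.Solves (fun _ => g) S .full R (MobileRobots.angleEqualization R .full) ∧
        ∀ pos : ℕ → MobileRobots.Config 4,
          pos 0 ∈ (MobileRobots.angleEqualization R .full).init →
          MobileRobots.IsExecution (fun _ => g) S .full R pos →
          ∀ t i, i ≠ 0 → pos t i = pos 0 i) ∧
    -- Angle Equalization from connected visibility graphs is a witness
    (∀ (r : ℝ) (hr : 0 < r) (S : MobileRobots.Scheduler),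
      MobileRobots.angleEqualization (MobileRobots.disorientedTeam 4 r hr) .limited ∈
        MobileRobots.Task S .full (MobileRobots.disorientedTeam 4 r hr) ∧
      ¬ ∃ f : MobileRobots.Algorithm,
        MobileRobots.Solves f S .limited (MobileRobots.disorientedTeam 4 r hr)
          (MobileRobots.angleEqualization (MobileRobots.disorientedTeam 4 r hr) .limited)) := by
  open MobileRobots in
  exact ⟨morePowerful_full_limited _, morePowerful_full_limited _,
    ⟨equalize, fun R S =>
      ⟨fun _ h0 hex => (correct_of_isExecution_equalize (V := .full) h0.1 hex).1,
        fun _ h0 hex => (correct_of_isExecution_equalize (V := .full) h0.1 hex).2⟩⟩,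
    fun r hr S => ⟨angleEqualization_mem_task_full _ _ S,
      fun ⟨f, hf⟩ => not_solves_limited f hr S hf⟩⟩
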